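/- Theorem B. Let $M$ be a compact connected smooth Riemannian manifold without boundary, of dimension $d$, let $\mathrm{dist}$ be the Riemannian distance and let $m$ be the Riemannian volume of $M$ normalized to $m(M)=1$ (Lebesgue measure). Let $f:M\to M$ be continuous and let $\mathcal S\subset M$ be a (possibly empty) compact embedded submanifold whose components have dimension smaller than $d$, such that $f$ is a $C^2$ local diffeomorphism at every point of $M\setminus\mathcal S$. Assume that $\mathcal S$ is a non-degenerate exceptional set for $f$: there are constants $B>1$ and $\beta>0$ such that, if $\mathcal S\neq\emptyset$, then for all $x\in M\setminus\mathcal S$ and $v\in T_xM$ $$\frac1B\,\mathrm{dist}(x,\mathcal S)^{\beta}\,\|v\|\le\|Df(x)v\|\le B\,\mathrm{dist}(x,\mathcal S)^{-\beta}\,\|v\| ,$$ and for all $x,y\in M\setminus\mathcal S$ with $\mathrm{dist}(x,y)<\mathrm{dist}(x,\mathcal S)/2$ $$\bigl|\log\|Df(x)^{-1}\|-\log\|Df(y)^{-1}\|\bigr|\le\frac{B}{\mathrm{dist}(x,\mathcal S)^{\beta}}\,\mathrm{dist}(x,y),\qquad \bigl|\log|\det Df(x)|-\log|\det Df(y)|\bigr|\le\frac{B}{\mathrm{dist}(x,\mathcal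 S)^{\beta}}\,\mathrm{dist}(x,y).$$ For $\delta>0$ let $\mathrm{dist}_\delta(x,\mathcal S)=\mathrm{dist}(x,\mathcal S)$ if $\mathcal S\neq\emptyset$ and $\mathrm{dist}(x,\mathcal S)\le\delta$, and $\mathrm{dist}_\delta(x,\mathcal S)=1$ otherwise. Fix $b$ with $0<b<\min\{1/2,1/(4\beta)\}$. For $0<\sigma<1$ and $\delta>0$, an integer $n\ge1$ is a $(\sigma,\delta)$-hyperbolic time for $x\in M$ if for all $1\le k\le n$ $$\prod_{j=n-k}^{n-1}\|Df(f^j(x))^{-1}\|\le\sigma^k\quad\text{and}\quad \mathrm{dist}_\delta(f^{n-k}(x),\mathcal S)\ge\sigma^{bk};$$ let $h(x)$ be the first $(\sigma,\delta)$-hyperbolic time of $x$ (and $h(x)=\infty$ if there is none). If for some $0<\sigma<1$ and $\delta>0$ the map $h$ is integrable with respect to $m$ (in particular finite $m$-almost everywhere), then $f$ has an invariant Borel probability measure that is absolutely continuous with respect to $m$. In fact, every Borel probability measure $\mu$ that is a weak* accumulation point of the averages $\mu_n=\frac1n\sum_{j=0}^{n-1}f^j_*m$ is $f$-invariant and absolutely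 continuous with respect to $m$. -/

import Mathlib

open MeasureTheory Filter Topology Bundle
open scoped Manifold ContDiff ENNReal

noncomputable section

namespace HyperbolicTimes

variable (d : ℕ) {M : Type*} [MetricSpace M] [ChartedSpace (EuclideanSpace ℝ (Fin d)) M]

/-- `S` is an embedded submanifold (of class `C^1`, without boundary) of the `d`-dimensional
manifold `M`, all of whose components have dimension smaller than `d`: around each of its points
there is a chart `e` of the maximal `C^1` atlas in which `S` is the slice `ℝ^k × {0}`, `k < d`. -/
def IsSubmanifoldOfLowerDim (S : Set M) : Prop :=
  ∀ p ∈ S, ∃ k < d, ∃ e ∈ IsManifold.maximalAtlas (𝓡 d) 1 M, p ∈ e.source ∧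
    ∀ x ∈ e.source, (x ∈ S ↔ ∀ i : Fin d, k ≤ (i : ℕ) → e x i = 0)

/-- The `δ`-truncated distance from `x` to `S`: it is `dist(x, S)` if this is at most `δ`, and `1`
otherwise. It is `1` if `S` is empty (the distance to the empty set being infinite). -/
def truncDist (δ : ℝ) (S : Set M) (x : M) : ℝ :=
  open Classical in if S.Nonempty ∧ Metric.infDist x S ≤ δ then Metric.infDist x S else 1

section Riemannian

variable [IsManifold (𝓡 d) ∞ M] [RiemannianBundle (fun x : M => TangentSpace (𝓡 d) x)]

/-- `‖Df(x)⁻¹‖`, the operator norm of the inverse of the derivative, for the Riemannian norms on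
the tangent spaces. It is meaningful where `Df(x)` is invertible. -/
def invDerivNorm (f : M → M) (x : M) : ℝ :=
  ‖(mfderiv (𝓡 d) (𝓡 d) f x).inverse‖

/-- `|det Df(x)|`, the absolute value of the determinant of `Df(x) : T_x M → T_{f x} M` in
orthonormal bases of the two tangent spaces. -/
def absDetDeriv (f : M → M) (x : M) : ℝ :=
  haveI : FiniteDimensional ℝ (TangentSpace (𝓡 d) x) :=
    inferInstanceAs (FiniteDimensional ℝ (EuclideanSpace ℝ (Fin d)))
  (mfderiv (𝓡 d) (𝓡 d) f x).toLinearMap.normDet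

/-- The non-degeneracy conditions of the exceptional set `S` of `f`, with constants `B` and `β`.
If `S` is empty then there is no condition (besides `1 < B` and `0 < β`). -/
structure IsNondegenerateExceptionalSet (f : M → M) (S : Set M) (B β : ℝ) : Prop where
  one_lt : 1 < B
  pos : 0 < β
  /-- `f` behaves like a power of the distance to `S`. -/
  lower_bound : S.Nonempty → ∀ x, x ∉ S → ∀ v : TangentSpace (𝓡 d) x,
    1 / B * Metric.infDist x S ^ β * ‖v‖ ≤ ‖mfderiv (𝓡 d) (𝓡 d) f x v‖
  upper_bound : S.Nonempty → ∀ x, x ∉ S → ∀ v : TangentSpace (𝓡 d) x,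
    ‖mfderiv (𝓡 d) (𝓡 d) f x v‖ ≤ B * Metric.infDist x S ^ (-β) * ‖v‖
  /-- `log ‖Df⁻¹‖` is locally Lipschitz, with constant controlled by the distance to `S`. -/
  log_inv : S.Nonempty → ∀ x, x ∉ S → ∀ y, y ∉ S → dist x y < Metric.infDist x S / 2 →
    |Real.log (invDerivNorm d f x) - Real.log (invDerivNorm d f y)|
      ≤ B / Metric.infDist x S ^ β * dist x y
  /-- `log |det Df|` is locally Lipschitz, with constant controlled by the distance to `S`. -/
  log_det : S.Nonempty → ∀ x, x ∉ S → ∀ y, y ∉ S → dist x y < Metric.infDist x S / 2 →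
    |Real.log (absDetDeriv d f x) - Real.log (absDetDeriv d f y)|
      ≤ B / Metric.infDist x S ^ β * dist x y

/-- `n` is a `(σ, δ)`-hyperbolic time for `x`. -/
def IsHyperbolicTime (f : M → M) (S : Set M) (b σ δ : ℝ) (n : ℕ) (x : M) : Prop :=
  ∀ k : ℕ, 1 ≤ k → k ≤ n →
    ∏ j ∈ Finset.Ico (n - k) n, invDerivNorm d f (f^[j] x) ≤ σ ^ k ∧
    σ ^ (b * (k : ℝ)) ≤ truncDist δ S (f^[n - k] x)

/-- The first `(σ, δ)`-hyperbolic time `h(x) ≥ 1` of `x`; it is `⊤` if `x` has none. -/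
def firstHyperbolicTime (f : M → M) (S : Set M) (b σ δ : ℝ) (x : M) : ℕ∞ :=
  ⨅ n ∈ {n : ℕ | 1 ≤ n ∧ IsHyperbolicTime d f S b σ δ n x}, (n : ℕ∞)

variable (M) [MeasurableSpace M]

/-- The Riemannian volume of the domain of the preferred chart `e` at `p`, as a measure on `M`: in
the chart, it is the measure `√(det (g_ij)) dy`, where `g_ij` are the inner products of the
coordinate vector fields. -/
def chartVolume (p : M) : Measure M :=
  let e := chartAt (EuclideanSpace ℝ (Fin d)) p
  ((volume.restrict e.target).withDensity fun y =>
    ENNReal.ofReal (Real.sqrt (Matrix.gram ℝ (fun i : Fin d =>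
      (mfderiv (𝓡 d) (𝓡 d) e.symm y (EuclideanSpace.single i (1 : ℝ)) :
        TangentSpace (𝓡 d) (e.symm y)))).det)).map e.symm

/-- The Riemannian volume of `M`: the smallest measure that dominates the volumes in all charts
(equivalently, the one that restricts to each of them on the domain of the chart). -/
def riemannianVolume : Measure M := ⨆ p : M, chartVolume d M p

/-- The normalized Riemannian volume `m`, called Lebesgue measure. -/
def lebesgue : Measure M := (riemannianVolume d M Set.univ)⁻¹ • riemannianVolume d M

/-- The averages `(1/n) ∑_{j < n} f^j_* m` of the iterates of Lebesgue measure. -/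
def cesaroAverage (f : M → M) (n : ℕ) : Measure M :=
  (n : ℝ≥0∞)⁻¹ • ∑ j ∈ Finset.range n, (lebesgue d M).map f^[j]

end Riemannian

/-- `μ` is a weak* accumulation point of the sequence of measures `ν`. -/
def IsWeakStarAccPt [MeasurableSpace M] (ν : ℕ → Measure M) (μ : Measure M) : Prop :=
  ∃ φ : ℕ → ℕ, StrictMono φ ∧
    ∀ g : C(M, ℝ), Tendsto (fun k => ∫ x, g x ∂ν (φ k)) atTop (𝓝 (∫ x, g x ∂μ))

end HyperbolicTimes

end

/-! ### Lifting Lipschitz paths through locally expanding maps. -/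

section PathLifting

open Metric Set

variable {X : Type*} [MetricSpace X]

/-! Let H(n) be the set of points having n as a hyperbolic time. The heart of the proof is a
constant C with m(H(n) ∩ f⁻ⁿA) ≤ C m(A) for all n and A. At a hyperbolic time n of x, the inverse
branch of fⁿ sending fⁿ(x) to x exists on a set U of fixed size. At time n - k its size is of order
σ^(k/2), while the distance to S is at least of order σ^(bk). Since b < 1/2 and bβ < 1/4, the branch
stays away from S and the variation of log |det Df| at that step is O(σ^(k/4)). The sum over k is
bounded independently of n (`exists_expandsWithDistortion_of_isHyperbolicTime`).

The inverse branch is built by lifting short paths backwards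
(`ExpandsWithDistortion.exists_section`). Branches over a connected U have equal or disjoint images;
on each image, bounded distortion compares relative volumes with those in U. Summing over the images
yields the density bound (`measure_expandsWithDistortion_inter_le`).

To handle f^j_* m, split M according to the last hyperbolic time i ≤ j of x. Hyperbolic times
concatenate, so f^i(x) has none in {1, ..., j - i}; hence it lies in T(l) = {h > l} with l = j - i.
Therefore f^j_* m ≤ C Σ_l f^l_*(m|T(l)) for every j. The right side is finite, because Σ m(T(l)) is
at most the integral of h, and it is absolutely continuous, because f pulls null sets back to null
sets (`exists_dominating_measure`). One finite measure thus dominates all averages and their weak*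
limits; invariance of the limits is the usual telescoping argument
(`exists_absolutelyContinuous_of_dominating`). -/

/-- `f` is expanding near `x` with rate `c⁻¹`: its local inverse near `x` is `c`-Lipschitz. -/
def IsLocallyExpandingAt (f : X → X) (c : ℝ) (x : X) : Prop :=
  ∃ U ∈ 𝓝 x, ∀ u ∈ U, ∀ v ∈ U, dist u v ≤ c * dist (f u) (f v)

/-- One local inverse serves all base points near a given one, so compactness of `K` makes the
radius uniform. The uniform radius allows a path to be lifted in finitely many equal steps. -/
theorem exists_uniform_local_section {f : X → X} {K : Set X} (hK : IsCompact K) {c : ℝ}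
    (hf : IsLocalHomeomorphOn f K) (hc : ∀ x ∈ K, IsLocallyExpandingAt f c x) :
    ∃ ε > 0, ∀ x ∈ K, ∃ g : X → X, g (f x) = x ∧ ∀ y ∈ ball (f x) ε, f (g y) = y ∧
      ∀ z ∈ ball (f x) ε, dist (g y) (g z) ≤ c * dist y z := by
  refine hK.induction_on (p := fun K => ∃ ε > 0, ∀ x ∈ K, ∃ g : X → X, g (f x) = x ∧
    ∀ y ∈ ball (f x) ε, f (g y) = y ∧ ∀ z ∈ ball (f x) ε, dist (g y) (g z) ≤ c * dist y z)
    ⟨1, one_pos, by simp⟩ ?_ ?_ ?_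
  · rintro s t hst ⟨ε, hε, h⟩
    exact ⟨ε, hε, fun x hx => h x (hst hx)⟩
  · rintro s t ⟨ε, hε, h⟩ ⟨ε', hε', h'⟩
    refine ⟨min ε ε', lt_min hε hε', fun x hx => ?_⟩
    rcases hx with hx | hx
    · obtain ⟨g, hg, hg'⟩ := h x hx
      exact ⟨g, hg, fun y hy => ⟨(hg' y (ball_subset_ball (min_le_left _ _) hy)).1, fun z hz =>
        (hg' y (ball_subset_ball (min_le_left _ _) hy)).2 z
          (ball_subset_ball (min_le_left _ _) hz)⟩⟩
    · obtain ⟨g, hg, hg'⟩ := h' x hx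
      exact ⟨g, hg, fun y hy => ⟨(hg' y (ball_subset_ball (min_le_right _ _) hy)).1, fun z hz =>
        (hg' y (ball_subset_ball (min_le_right _ _) hy)).2 z
          (ball_subset_ball (min_le_right _ _) hz)⟩⟩
  · intro x₀ hx₀
    obtain ⟨e, he, rfl⟩ := hf x₀ hx₀
    obtain ⟨U, hU, hUc⟩ := hc x₀ hx₀
    have hW : e.source ∩ interior U ∈ 𝓝 x₀ :=
      inter_mem (e.open_source.mem_nhds he) (interior_mem_nhds.2 hU)
    have hO : e '' (e.source ∩ interior U) ∈ 𝓝 (e x₀) := e.image_mem_nhds he hW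
    obtain ⟨r, hr, hball⟩ := Metric.mem_nhds_iff.1 hO
    -- With half the radius, the ball about `e x` stays in the ball about `e x₀` for every nearby
    -- `x`.
    have hW' : (e.source ∩ interior U) ∩ e ⁻¹' ball (e x₀) (r / 2) ∈ 𝓝 x₀ :=
      inter_mem hW ((e.continuousAt he).preimage_mem_nhds (ball_mem_nhds _ (half_pos hr)))
    refine ⟨_, mem_nhdsWithin_of_mem_nhds hW', r / 2, half_pos hr, fun x hx => ⟨e.symm,
      e.left_inv hx.1.1, ?_⟩⟩
    have key : ∀ y ∈ ball (e x) (r / 2), e.symm y ∈ e.source ∩ interior U ∧ e (e.symm y) = y := by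
      intro y hy
      have : y ∈ ball (e x₀) r := by
        have h2 := mem_ball.1 hx.2
        rw [mem_ball] at hy ⊢
        linarith [dist_triangle y (e x) (e x₀)]
      obtain ⟨w, hw, rfl⟩ := hball this
      rw [e.left_inv hw.1]
      exact ⟨hw, rfl⟩
    intro y hy
    refine ⟨(key y hy).2, fun z hz => ?_⟩
    have := hUc _ (interior_subset (key y hy).1.2) _ (interior_subset (key z hz).1.2)
    rwa [(key y hy).2, (key z hz).2] at this

/-- The lift starts at `w` and is `c * ℓ`-Lipschitz on a unit interval, so it never leaves the
compact ball where local sections of uniform radius exist. The path is cut into `N` pieces, each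
contained in a ball of that radius. -/
theorem exists_lipschitz_lift [CompactSpace X] {f : X → X} {w : X} {c ℓ : ℝ} (hc : 0 ≤ c)
    (hℓ : 0 ≤ ℓ) (hf : IsLocalHomeomorphOn f (closedBall w (c * ℓ)))
    (hexp : ∀ x ∈ closedBall w (c * ℓ), IsLocallyExpandingAt f c x)
    {γ : ℝ → X} (hγ : ∀ s ∈ Icc (0 : ℝ) 1, ∀ t ∈ Icc (0 : ℝ) 1, dist (γ s) (γ t) ≤ ℓ * |s - t|)
    (hγ0 : γ 0 = f w) :
    ∃ η : ℝ → X, η 0 = w ∧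
      (∀ s ∈ Icc (0 : ℝ) 1, ∀ t ∈ Icc (0 : ℝ) 1, dist (η s) (η t) ≤ c * ℓ * |s - t|) ∧
      ∀ t ∈ Icc (0 : ℝ) 1, f (η t) = γ t := by
  obtain ⟨ε, hε, hloc⟩ :=
    exists_uniform_local_section (isClosed_closedBall (x := w) (ε := c * ℓ)).isCompact hf hexp
  obtain ⟨N, hN⟩ := exists_nat_gt (ℓ / ε)
  have hN0 : (0 : ℝ) < N := lt_of_le_of_lt (by positivity) hN
  have hNε : ℓ * (1 / N) < ε := by
    rw [div_lt_iff₀ hε] at hN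
    rw [mul_one_div, div_lt_iff₀ hN0]; linarith
  have hcℓ : 0 ≤ c * ℓ := mul_nonneg hc hℓ
  have main : ∀ i : ℕ, i ≤ N → ∃ η : ℝ → X, η 0 = w ∧
      (∀ s ∈ Icc (0 : ℝ) (i / N), ∀ t ∈ Icc (0 : ℝ) (i / N),
        dist (η s) (η t) ≤ c * ℓ * |s - t|) ∧
      ∀ t ∈ Icc (0 : ℝ) (i / N), f (η t) = γ t := by
    intro i
    induction i with
    | zero =>
      intro _
      refine ⟨fun _ => w, rfl, fun s _ t _ => by simpa using mul_nonneg hcℓ (abs_nonneg _), ?_⟩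
      intro t ht
      simp only [Nat.cast_zero, zero_div, Icc_self, mem_singleton_iff] at ht
      rw [ht, hγ0]
    | succ i ih =>
      intro hi
      obtain ⟨η, hη0, hηL, hηf⟩ := ih (by omega)
      set T : ℝ := i / N with hT
      have hT0 : 0 ≤ T := by positivity
      have hT' : ((i + 1 : ℕ) : ℝ) / N = T + 1 / N := by rw [hT]; push_cast; ring
      have hT1 : T + 1 / N ≤ 1 := by
        rw [← hT', div_le_one hN0]; exact_mod_cast hi
      have hNinv : 0 < 1 / (N : ℝ) := by positivity
      have hTK : η T ∈ closedBall w (c * ℓ) := by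
        rw [mem_closedBall, ← hη0]
        refine (hηL T ⟨hT0, le_rfl⟩ 0 ⟨le_rfl, hT0⟩).trans ?_
        rw [sub_zero, abs_of_nonneg hT0]
        exact mul_le_of_le_one_right hcℓ (by linarith)
      obtain ⟨g, hg0, hg⟩ := hloc _ hTK
      have hfT : f (η T) = γ T := hηf T ⟨hT0, le_rfl⟩
      rw [hfT] at hg0 hg
      have hin : ∀ t ∈ Icc T (T + 1 / N), γ t ∈ ball (γ T) ε := by
        intro t ht
        rw [mem_ball]
        refine (hγ t ⟨by linarith [ht.1], by linarith [ht.2]⟩ T ⟨hT0, by linarith⟩).trans_lt ?_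
        refine lt_of_le_of_lt (mul_le_mul_of_nonneg_left ?_ hℓ) hNε
        rw [abs_of_nonneg (by linarith [ht.1])]
        linarith [ht.2]
      have hgL : ∀ s ∈ Icc T (T + 1 / N), ∀ t ∈ Icc T (T + 1 / N),
          dist (g (γ s)) (g (γ t)) ≤ c * ℓ * |s - t| := by
        intro s hs t ht
        refine ((hg _ (hin s hs)).2 _ (hin t ht)).trans ?_
        rw [mul_assoc]
        exact mul_le_mul_of_nonneg_left (hγ s ⟨by linarith [hs.1], by linarith [hs.2]⟩ t
          ⟨by linarith [ht.1], by linarith [ht.2]⟩) hc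
      -- No constant is lost at the junction: for s ≤ T ≤ t the distances |s - T| and |T - t| add up
      -- to |s - t|.
      have hmix : ∀ s ∈ Icc 0 T, ∀ t ∈ Icc T (T + 1 / N),
          dist (η s) (g (γ t)) ≤ c * ℓ * |s - t| := by
        intro s hs t ht
        have h1 := hηL s hs T ⟨hT0, le_rfl⟩
        have h2 := hgL T ⟨le_rfl, by linarith⟩ t ht
        rw [hg0] at h2
        rw [abs_of_nonpos (by linarith [hs.2])] at h1
        rw [abs_of_nonpos (by linarith [ht.1])] at h2
        rw [abs_of_nonpos (by linarith [hs.2, ht.1])]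
        calc dist (η s) (g (γ t)) ≤ _ := dist_triangle _ (η T) _
          _ ≤ c * ℓ * -(s - T) + c * ℓ * -(T - t) := add_le_add h1 h2
          _ = c * ℓ * -(s - t) := by ring
      refine ⟨fun t => if t ≤ T then η t else g (γ t), by simp [hT0, hη0], ?_, ?_⟩
      · intro s hs t ht
        rw [hT'] at hs ht
        rcases le_or_gt s T with hsT | hsT <;> rcases le_or_gt t T with htT | htT
        · simp only [hsT, htT, if_true]; exact hηL s ⟨hs.1, hsT⟩ t ⟨ht.1, htT⟩
        · simp only [hsT, htT.not_ge, if_true, if_false]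
          exact hmix s ⟨hs.1, hsT⟩ t ⟨htT.le, ht.2⟩
        · simp only [hsT.not_ge, htT, if_true, if_false]
          rw [dist_comm, abs_sub_comm]
          exact hmix t ⟨ht.1, htT⟩ s ⟨hsT.le, hs.2⟩
        · simp only [hsT.not_ge, htT.not_ge, if_false]
          exact hgL s ⟨hsT.le, hs.2⟩ t ⟨htT.le, ht.2⟩
      · intro t ht
        rw [hT'] at ht
        rcases le_or_gt t T with htT | htT
        · simp only [htT, if_true]; exact hηf t ⟨ht.1, htT⟩
        · simp only [htT.not_ge, if_false]; exact (hg _ (hin t ⟨htT.le, ht.2⟩)).1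
  obtain ⟨η, h⟩ := main N le_rfl
  rw [div_self hN0.ne'] at h
  exact ⟨η, h⟩

/-- Lifting back from time n to time k multiplies the Lipschitz constant by c(k)⋯c(n-1), exactly the
radius on which `f` is controlled there. Single factors may exceed 1; only these tail products
enter. -/
theorem exists_lipschitz_lift_iterate [CompactSpace X] {f : X → X} {ρ : ℝ} (hρ : 0 ≤ ρ) (n : ℕ)
    (x : X) (c : ℕ → ℝ) (hc : ∀ k, 0 ≤ c k)
    (hf : ∀ k < n, IsLocalHomeomorphOn f (closedBall (f^[k] x) ((∏ j ∈ Finset.Ico k n, c j) * ρ)))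
    (hexp : ∀ k < n, ∀ u ∈ closedBall (f^[k] x) ((∏ j ∈ Finset.Ico k n, c j) * ρ),
      IsLocallyExpandingAt f (c k) u)
    {γ : ℝ → X} (hγ : ∀ s ∈ Icc (0 : ℝ) 1, ∀ t ∈ Icc (0 : ℝ) 1, dist (γ s) (γ t) ≤ ρ * |s - t|)
    (hγ0 : γ 0 = f^[n] x) :
    ∃ η : ℝ → X, η 0 = x ∧ (∀ k ≤ n, ∀ s ∈ Icc (0 : ℝ) 1, ∀ t ∈ Icc (0 : ℝ) 1,
      dist (f^[k] (η s)) (f^[k] (η t)) ≤ (∏ j ∈ Finset.Ico k n, c j) * ρ * |s - t|) ∧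
      ∀ t ∈ Icc (0 : ℝ) 1, f^[n] (η t) = γ t := by
  induction n generalizing x c with
  | zero =>
    refine ⟨γ, hγ0, fun k hk s hs t ht => ?_, fun t _ => rfl⟩
    obtain rfl : k = 0 := by omega
    simpa using hγ s hs t ht
  | succ n ih =>
    have hshift : ∀ k, ∏ j ∈ Finset.Ico k n, c (j + 1) = ∏ j ∈ Finset.Ico (k + 1) (n + 1), c j :=
      fun k => Finset.prod_Ico_add' c k n 1
    obtain ⟨η', h0, hL, hη'⟩ := ih (f x) (fun k => c (k + 1)) (fun k => hc _)
      (fun k hk => by rw [hshift, ← Function.iterate_succ_apply]; exact hf (k + 1) (by omega))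
      (fun k hk => by rw [hshift, ← Function.iterate_succ_apply]; exact hexp (k + 1) (by omega))
      (by rw [hγ0, Function.iterate_succ_apply])
    have hprod : ∏ j ∈ Finset.Ico 0 (n + 1), c j = c 0 * ∏ j ∈ Finset.Ico 1 (n + 1), c j := by
      rw [Finset.prod_eq_prod_Ico_succ_bot (by omega)]
    have h0f := hf 0 (by omega)
    have h0e := hexp 0 (by omega)
    rw [hprod, mul_assoc] at h0f h0e
    have hL0 := hL 0 (by omega)
    rw [hshift] at hL0
    obtain ⟨η, hη0, hηL, hηf⟩ := exists_lipschitz_lift (hc 0)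
      (mul_nonneg (Finset.prod_nonneg fun _ _ => hc _) hρ) h0f h0e hL0 h0
    refine ⟨η, hη0, fun k hk s hs t ht => ?_, fun t ht => ?_⟩
    · rcases k with _ | k
      · rw [hprod, mul_assoc (c 0)]; exact hηL s hs t ht
      · rw [Function.iterate_succ_apply, Function.iterate_succ_apply, hηf s hs, hηf t ht, ← hshift]
        exact hL k (by omega) s hs t ht
    · rw [Function.iterate_succ_apply, hηf t ht]
      exact hη' t ht

end PathLifting

/-! ### Inverse branches of iterates and the uniform density bound. -/

section Preballs

open Metric Set

variable {X : Type*} [MetricSpace X]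

/-- Any two points of `U` are joined by `ρ`-Lipschitz paths that depend continuously on the
endpoint. -/
def HasShortPaths (ρ : ℝ) (U : Set X) : Prop :=
  ∀ y : U, ∃ H : C(unitInterval × U, X), (∀ u, H (0, u) = y) ∧ (∀ u, H (1, u) = u) ∧
    (∀ t, H (t, y) = y) ∧ ∀ s t u, dist (H (s, u)) (H (t, u)) ≤ ρ * |(s : ℝ) - t|

/-- Along the first `n` iterates of `x`, the map `f` expands neighborhoods that shrink down from
the scale `ρ` at time `n`, with total distortion of `J` at most `exp K`. -/
def ExpandsWithDistortion (f : X → X) (S : Set X) (J : X → ℝ) (ρ K : ℝ) (n : ℕ) (x : X) : Prop :=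
  ∃ c κ : ℕ → ℝ, (∀ k, 0 ≤ c k) ∧ ∑ k ∈ Finset.range n, κ k ≤ K ∧
    ∀ k < n, ∀ u ∈ closedBall (f^[k] x) ((∏ j ∈ Finset.Ico k n, c j) * ρ),
      u ∉ S ∧ IsLocallyExpandingAt f (c k) u ∧
      J u ≤ Real.exp (κ k) * J (f^[k] x) ∧ Real.exp (-κ k) * J (f^[k] x) ≤ J u

/-- The points whose first `n` iterates avoid `S`. -/
def avoiding (f : X → X) (S : Set X) (n : ℕ) : Set X := {z | ∀ k < n, f^[k] z ∉ S}

theorem isOpen_avoiding {f : X → X} (hf : Continuous f) {S : Set X} (hS : IsClosed S) (n : ℕ) :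
    IsOpen (avoiding f S n) := by
  have : avoiding f S n = ⋂ k ∈ Finset.range n, (f^[k]) ⁻¹' Sᶜ := by
    ext; simp [avoiding]
  rw [this]
  exact isOpen_biInter_finset fun k _ => hS.isOpen_compl.preimage (hf.iterate k)

theorem isLocalHomeomorphOn_iterate {f : X → X} {S : Set X} (hf : IsLocalHomeomorphOn f Sᶜ)
    (n : ℕ) : IsLocalHomeomorphOn f^[n] (avoiding f S n) := by
  induction n with
  | zero => exact fun x _ => ⟨OpenPartialHomeomorph.refl X, trivial, rfl⟩
  | succ n ih =>
    rw [Function.iterate_succ']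
    exact hf.comp (ih.mono fun x hx k hk => hx k (by omega)) fun x hx => hx n (by omega)

theorem isLocalHomeomorph_iterate_avoiding {f : X → X} {S : Set X}
    (hfc : Continuous f) (hS : IsClosed S) (hf : IsLocalHomeomorphOn f Sᶜ) (n : ℕ) :
    IsLocalHomeomorph (fun z : avoiding f S n => f^[n] z) := by
  have h1 : IsLocalHomeomorph (Subtype.val : avoiding f S n → X) :=
    (isOpen_avoiding hfc hS n).isOpenEmbedding_subtypeVal.isLocalHomeomorph
  rw [isLocalHomeomorph_iff_isLocalHomeomorphOn_univ] at h1 ⊢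
  exact (isLocalHomeomorphOn_iterate hf n).comp h1 fun z _ => z.2

/-- Inverse branches of `f^n` on `U`. -/
theorem ExpandsWithDistortion.exists_section [CompactSpace X] {f : X → X} {S : Set X} {J : X → ℝ}
    {ρ K : ℝ} {n : ℕ} {x : X} (hx : ExpandsWithDistortion f S J ρ K n x)
    (hfc : Continuous f) (hS : IsClosed S) (hf : IsLocalHomeomorphOn f Sᶜ)
    (hρ : 0 ≤ ρ) {U : Set X} (hU : HasShortPaths ρ U) (hxU : f^[n] x ∈ U) :
    ∃ g : U → avoiding f S n, Continuous g ∧ (∀ u, f^[n] (g u) = u) ∧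
      (g ⟨_, hxU⟩ : X) = x ∧ ∃ κ : ℕ → ℝ, ∑ k ∈ Finset.range n, κ k ≤ K ∧ ∀ u, ∀ k < n,
        J (f^[k] (g u)) ≤ Real.exp (κ k) * J (f^[k] x) ∧
        Real.exp (-κ k) * J (f^[k] x) ≤ J (f^[k] (g u)) := by
  obtain ⟨c, κ, hc, hκ, h⟩ := hx
  obtain ⟨H, H0, H1, Hy, HL⟩ := hU ⟨_, hxU⟩
  have lift : ∀ u : U, ∃ η : unitInterval → avoiding f S n, Continuous η ∧ (η 0 : X) = x ∧
      (∀ t, f^[n] (η t) = H (t, u)) ∧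
      ∀ k < n, f^[k] (η 1) ∈ closedBall (f^[k] x) ((∏ j ∈ Finset.Ico k n, c j) * ρ) := by
    intro u
    obtain ⟨η, h0, hL, hη⟩ := exists_lipschitz_lift_iterate hρ n x c hc
      (fun k hk => hf.mono fun v hv => (h k hk v hv).1) (fun k hk u hu => (h k hk u hu).2.1)
      (γ := fun t => H (projIcc 0 1 zero_le_one t, u)) (fun s hs t ht => by
        have := HL (projIcc 0 1 zero_le_one s) (projIcc 0 1 zero_le_one t) u
        rwa [projIcc_of_mem _ hs, projIcc_of_mem _ ht] at this ⊢) (by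
        have : projIcc (0 : ℝ) 1 zero_le_one 0 = 0 := projIcc_left _
        rw [this, H0])
    have hmem : ∀ t ∈ Icc (0 : ℝ) 1, ∀ k < n,
        f^[k] (η t) ∈ closedBall (f^[k] x) ((∏ j ∈ Finset.Ico k n, c j) * ρ) := by
      intro t ht k hk
      have := hL k hk.le t ht 0 ⟨le_rfl, zero_le_one⟩
      rw [h0, sub_zero, abs_of_nonneg ht.1] at this
      exact this.trans (mul_le_of_le_one_right
        (mul_nonneg (Finset.prod_nonneg fun _ _ => hc _) hρ) ht.2)
    refine ⟨fun t => ⟨η t, fun k hk => (h k hk _ (hmem t t.2 k hk)).1⟩, ?_, by simpa using h0,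
      fun t => ?_, fun k hk => by simpa using hmem 1 ⟨zero_le_one, le_rfl⟩ k hk⟩
    · refine Continuous.subtype_mk ?_ _
      have h00 := hL 0 (Nat.zero_le n)
      refine continuous_iff_continuousAt.2 fun t => ?_
      refine tendsto_iff_dist_tendsto_zero.2 (squeeze_zero (fun _ => dist_nonneg)
        (fun s => h00 s s.2 t t.2) ?_)
      have : Continuous fun s : unitInterval =>
          (∏ j ∈ Finset.Ico 0 n, c j) * ρ * |(s : ℝ) - t| := by fun_prop
      simpa using this.tendsto t
    · simpa using hη t t.2
  choose η hηc hη0 hηf hη1 using lift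
  have hp := isLocalHomeomorph_iterate_avoiding hfc hS hf n
  have hsep : IsSeparatedMap (fun z : avoiding f S n => f^[n] z) := T2Space.isSeparatedMap _
  -- The paths were lifted one endpoint at a time. Joint continuity is homotopy lifting: the lifts
  -- are continuous in time and all start at `x`.
  have hcont : Continuous fun a : unitInterval × U => η a.2 a.1 := by
    refine hp.continuous_lift hsep H (g := fun a => η a.2 a.1) (funext fun a => hηf _ _) ?_ hηc
    have : (fun u : U => η u 0) = fun _ => η ⟨_, hxU⟩ 0 :=
      funext fun u => Subtype.ext ((hη0 u).trans (hη0 _).symm)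
    change Continuous fun u : U => η u 0
    rw [this]
    exact continuous_const
  refine ⟨fun u => η u 1, hcont.comp (Continuous.prodMk_right 1), fun u => (hηf u 1).trans (H1 u),
    ?_, κ, hκ, fun u k hk => (h k hk _ (hη1 u k hk)).2.2⟩
  -- The path from `f^[n] x` to itself is constant, hence so is its lift, which starts at `x`.
  have := hsep.const_of_comp hp.isLocallyInjective (hηc ⟨_, hxU⟩)
    (fun s t => by simp only [hηf, Hy]) 1 0
  exact (congrArg Subtype.val this).trans (hη0 _)

variable [MeasurableSpace X] [BorelSpace X]

/-- The function `J` controls the volume expansion of `f` off the set `S`. -/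
def ControlsVolume (f : X → X) (S : Set X) (J : X → ℝ) (m : Measure X) : Prop :=
  ∀ A : Set X, MeasurableSet A → A ⊆ Sᶜ → InjOn f A → ∀ α : ℝ, 0 ≤ α →
    ((∀ x ∈ A, J x ≤ α) → m (f '' A) ≤ ENNReal.ofReal α * m A) ∧
    ((∀ x ∈ A, α ≤ J x) → ENNReal.ofReal α * m A ≤ m (f '' A))

/-- The one-step bounds multiply along the orbit. In applications `j k` is `J` on a reference orbit
and `κ k` bounds the deviation of log J from it. -/
theorem ControlsVolume.iterate [CompactSpace X] {f : X → X} {S : Set X} {J : X → ℝ} {m : Measure X}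
    (hJ : ControlsVolume f S J m) (hfc : Continuous f)
    {n : ℕ} {A : Set X} (hA : MeasurableSet A) (hAS : A ⊆ avoiding f S n) (hinj : InjOn f^[n] A)
    {j κ : ℕ → ℝ} (hj : ∀ k < n, 0 ≤ j k)
    (hAJ : ∀ x ∈ A, ∀ k < n, J (f^[k] x) ≤ Real.exp (κ k) * j k ∧
      Real.exp (-κ k) * j k ≤ J (f^[k] x)) :
    m (f^[n] '' A) ≤ ENNReal.ofReal (Real.exp (∑ k ∈ Finset.range n, κ k) *
      ∏ k ∈ Finset.range n, j k) * m A ∧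
    ENNReal.ofReal (Real.exp (-∑ k ∈ Finset.range n, κ k) *
      ∏ k ∈ Finset.range n, j k) * m A ≤ m (f^[n] '' A) := by
  induction n with
  | zero => simp
  | succ n ih =>
    have hinj' : InjOn f^[n] A := by
      intro x hx y hy hxy
      refine hinj hx hy ?_
      simp only [Function.iterate_succ_apply', hxy]
    obtain ⟨ih1, ih2⟩ := ih (fun x hx k hk => hAS hx k (by omega)) hinj'
      (fun k hk => hj k (by omega)) (fun x hx k hk => hAJ x hx k (by omega))
    have hmeas : MeasurableSet (f^[n] '' A) :=
      hA.image_of_continuousOn_injOn (hfc.iterate n).continuousOn hinj'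
    have hsub : f^[n] '' A ⊆ Sᶜ := by
      rintro _ ⟨x, hx, rfl⟩
      exact hAS hx n (by omega)
    have hinjf : InjOn f (f^[n] '' A) := by
      rintro _ ⟨x, hx, rfl⟩ _ ⟨y, hy, rfl⟩ hxy
      rw [← Function.iterate_succ_apply' f, ← Function.iterate_succ_apply' f] at hxy
      rw [hinj hx hy hxy]
    have hjn := hj n (by omega)
    have himg : f^[n + 1] '' A = f '' (f^[n] '' A) := by
      rw [Function.iterate_succ', image_comp]
    have hprod : 0 ≤ ∏ k ∈ Finset.range n, j k :=
      Finset.prod_nonneg fun k hk => hj k (by have := Finset.mem_range.1 hk; omega)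
    rw [himg, Finset.sum_range_succ, Finset.prod_range_succ]
    constructor
    · refine ((hJ _ hmeas hsub hinjf (Real.exp (κ n) * j n) (by positivity)).1 ?_).trans ?_
      · rintro _ ⟨x, hx, rfl⟩
        exact (hAJ x hx n (by omega)).1
      · refine (mul_le_mul_right ih1 _).trans_eq ?_
        rw [← mul_assoc, ← ENNReal.ofReal_mul (by positivity), Real.exp_add]
        congr 2; ring
    · refine le_trans ?_ ((hJ _ hmeas hsub hinjf (Real.exp (-κ n) * j n) (by positivity)).2 ?_)
      · refine Eq.trans_le ?_ (mul_le_mul_right ih2 _)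
        rw [← mul_assoc (ENNReal.ofReal _) (ENNReal.ofReal _),
          ← ENNReal.ofReal_mul (by positivity), neg_add, Real.exp_add]
        congr 2; ring
      · rintro _ ⟨x, hx, rfl⟩
        exact (hAJ x hx n (by omega)).2

/-- The images under `f^n` of the restriction of `m` to the points with controlled expansion up to
time `n` have a density bounded independently of `n`. -/
theorem measure_expandsWithDistortion_inter_le [CompactSpace X] {f : X → X} {S : Set X} {J : X → ℝ}
    {m : Measure X} [IsFiniteMeasure m] (hJ : ControlsVolume f S J m) (hJ0 : ∀ x ∉ S, 0 < J x)
    (hfc : Continuous f) (hS : IsClosed S) (hf : IsLocalHomeomorphOn f Sᶜ)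
    {ρ K : ℝ} (hρ : 0 ≤ ρ) (n : ℕ) {U : Set X} (hUo : IsOpen U) (hUc : IsPreconnected U)
    (hU : HasShortPaths ρ U) {A : Set X} (hA : MeasurableSet A) (hAU : A ⊆ U) :
    m ({x | ExpandsWithDistortion f S J ρ K n x} ∩ f^[n] ⁻¹' A) * m U ≤
      ENNReal.ofReal (Real.exp (2 * K)) * m A * m univ := by
  let Z := {x | ExpandsWithDistortion f S J ρ K n x ∧ f^[n] x ∈ U}
  have hp := isLocalHomeomorph_iterate_avoiding hfc hS hf n
  have hsep : IsSeparatedMap (fun z : avoiding f S n => f^[n] z) := T2Space.isSeparatedMap _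
  have hsec := fun z : Z => z.2.1.exists_section hfc hS hf hρ hU z.2.2
  choose g hgc hgf hgz hgJ using hsec
  let V : Z → Set X := fun z => range fun u => (g z u : X)
  have hzV : ∀ z : Z, (z : X) ∈ V z := fun z => ⟨_, hgz z⟩
  have hVavoid : ∀ z, V z ⊆ avoiding f S n := by
    rintro z _ ⟨u, rfl⟩; exact (g z u).2
  have hVo : ∀ z, IsOpen (V z) := by
    intro z
    have h1 : IsLocalHomeomorph (g z) := by
      have : (fun z : avoiding f S n => f^[n] z) ∘ g z = Subtype.val := funext fun u => hgf z u
      exact IsLocalHomeomorph.of_comp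
        (this ▸ hUo.isOpenEmbedding_subtypeVal.isLocalHomeomorph) hp (hgc z)
    have h2 := (isOpen_avoiding hfc hS n).isOpenMap_subtype_val.comp h1.isOpenMap
    exact h2.isOpen_range
  have hVinj : ∀ z, InjOn f^[n] (V z) := by
    rintro z _ ⟨u, rfl⟩ _ ⟨v, rfl⟩ huv
    simp only [hgf] at huv
    rw [Subtype.ext huv]
  have hVim : ∀ z, f^[n] '' V z = U := by
    intro z
    ext y
    constructor
    · rintro ⟨_, ⟨u, rfl⟩, rfl⟩
      simp only [hgf]; exact u.2
    · intro hy
      exact ⟨_, ⟨⟨y, hy⟩, rfl⟩, hgf z _⟩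
  have : PreconnectedSpace U := Subtype.preconnectedSpace hUc
  -- Lifts over the connected `U` that agree at one point agree everywhere, so distinct images are
  -- disjoint. Being nonempty and open, they are countably many.
  have hVeq : ∀ z w, (V z ∩ V w).Nonempty → V z = V w := by
    rintro z w ⟨_, ⟨u, rfl⟩, ⟨v, hv⟩⟩
    have huv : u = v := by
      have := congrArg (f^[n]) hv
      simp only [hgf] at this
      exact (Subtype.ext this).symm
    subst huv
    have : g z = g w := hsep.eq_of_comp_eq hp.isLocallyInjective (hgc z) (hgc w)
      (funext fun u => (hgf z u).trans (hgf w u).symm) u (Subtype.ext hv.symm)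
    simp only [V, this]
  have hdisj : (range V).PairwiseDisjoint id := by
    rintro _ ⟨z, rfl⟩ _ ⟨w, rfl⟩ hzw
    rw [Function.onFun, id, id, disjoint_iff_inter_eq_empty]
    by_contra h
    exact hzw (hVeq z w (nonempty_iff_ne_empty.2 h))
  have hcount : (range V).Countable :=
    hdisj.countable_of_isOpen (by rintro _ ⟨z, rfl⟩; exact hVo z)
      (by rintro _ ⟨z, rfl⟩; exact ⟨z, hzV z⟩)
  have hpre : MeasurableSet (f^[n] ⁻¹' A) := (hfc.iterate n).measurable hA
  have hcover : {x | ExpandsWithDistortion f S J ρ K n x} ∩ f^[n] ⁻¹' A ⊆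
      ⋃ W ∈ range V, W ∩ f^[n] ⁻¹' A := by
    rintro x ⟨hx, hxA⟩
    exact mem_biUnion ⟨⟨x, hx, hAU hxA⟩, rfl⟩ ⟨hzV ⟨x, hx, hAU hxA⟩, hxA⟩
  -- The upper volume bound for all of W and the lower one for the part over `A` are multiplied. The
  -- Jacobian product `P` of the reference orbit cancels, leaving only the distortion factor
  -- exp(2s).
  have hpiece : ∀ W ∈ range V, m (W ∩ f^[n] ⁻¹' A) * m U ≤
      ENNReal.ofReal (Real.exp (2 * K)) * m A * m W := by
    rintro _ ⟨z, rfl⟩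
    obtain ⟨κ, hκ, hκJ⟩ := hgJ z
    have hjpos : ∀ k < n, 0 < J (f^[k] z) := fun k hk => hJ0 _ (hVavoid z (hzV z) k hk)
    have hbd : ∀ x ∈ V z, ∀ k < n, J (f^[k] x) ≤ Real.exp (κ k) * J (f^[k] z) ∧
        Real.exp (-κ k) * J (f^[k] z) ≤ J (f^[k] x) := by
      rintro _ ⟨u, rfl⟩ k hk
      exact hκJ u k hk
    have h1 := (hJ.iterate hfc (hVo z).measurableSet (hVavoid z) (hVinj z)
      (fun k hk => (hjpos k hk).le) hbd).1
    have h2 := (hJ.iterate hfc ((hVo z).measurableSet.inter hpre)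
      (inter_subset_left.trans (hVavoid z)) ((hVinj z).mono inter_subset_left)
      (fun k hk => (hjpos k hk).le) (fun x hx => hbd x hx.1)).2
    rw [hVim] at h1
    have h3 : m (f^[n] '' (V z ∩ f^[n] ⁻¹' A)) ≤ m A :=
      measure_mono (by rintro _ ⟨x, hx, rfl⟩; exact hx.2)
    have h2 := h2.trans h3
    set s := ∑ k ∈ Finset.range n, κ k
    set P := ∏ k ∈ Finset.range n, J (f^[k] z)
    have hP : 0 < P := Finset.prod_pos fun k hk => hjpos k (Finset.mem_range.1 hk)
    have hne : ENNReal.ofReal (Real.exp (-s) * P) ≠ 0 := by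
      rw [ENNReal.ofReal_ne_zero_iff]; positivity
    rw [← ENNReal.mul_le_mul_iff_right hne ENNReal.ofReal_ne_top]
    calc ENNReal.ofReal (Real.exp (-s) * P) * (m (V z ∩ f^[n] ⁻¹' A) * m U)
        = (ENNReal.ofReal (Real.exp (-s) * P) * m (V z ∩ f^[n] ⁻¹' A)) * m U := by ring
      _ ≤ m A * (ENNReal.ofReal (Real.exp s * P) * m (V z)) := mul_le_mul' h2 h1
      _ ≤ m A * (ENNReal.ofReal (Real.exp (-s) * P) * ENNReal.ofReal (Real.exp (2 * K)) *
          m (V z)) := by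
        gcongr
        rw [← ENNReal.ofReal_mul (by positivity)]
        apply ENNReal.ofReal_le_ofReal
        have : Real.exp s ≤ Real.exp (-s) * Real.exp (2 * K) := by
          rw [← Real.exp_add]; exact Real.exp_le_exp.2 (by linarith)
        nlinarith
      _ = _ := by ring
  have : Countable (range V) := hcount
  calc m ({x | ExpandsWithDistortion f S J ρ K n x} ∩ f^[n] ⁻¹' A) * m U
      ≤ (∑' W : range V, m (W ∩ f^[n] ⁻¹' A)) * m U := by
        gcongr
        exact (measure_mono hcover).trans (measure_biUnion_le m hcount _)
    _ = ∑' W : range V, m (W ∩ f^[n] ⁻¹' A) * m U := ENNReal.tsum_mul_right.symm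
    _ ≤ ∑' W : range V, ENNReal.ofReal (Real.exp (2 * K)) * m A * m W :=
        ENNReal.tsum_le_tsum fun W => hpiece W W.2
    _ = ENNReal.ofReal (Real.exp (2 * K)) * m A * ∑' W : range V, m W := ENNReal.tsum_mul_left
    _ ≤ ENNReal.ofReal (Real.exp (2 * K)) * m A * m univ := by
        gcongr
        rw [← measure_biUnion (f := fun W => W) hcount hdisj
          (by rintro _ ⟨z, rfl⟩; exact (hVo z).measurableSet)]
        exact measure_mono (subset_univ _)

end Preballs

/-! ### Averages of push-forwards and their weak* limits. -/

section Averages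

open Set

variable {X : Type*} [MetricSpace X] [MeasurableSpace X] [BorelSpace X]

/-- The averages `(1/n) ∑_{j < n} f^j_* m`. -/
noncomputable def orbitAverage (f : X → X) (m : Measure X) (n : ℕ) : Measure X :=
  (n : ℝ≥0∞)⁻¹ • ∑ j ∈ Finset.range n, m.map f^[j]

theorem orbitAverage_apply {f : X → X} (hf : Continuous f) (m : Measure X) (n : ℕ) {A : Set X}
    (hA : MeasurableSet A) :
    orbitAverage f m n A = (n : ℝ≥0∞)⁻¹ * ∑ j ∈ Finset.range n, m (f^[j] ⁻¹' A) := by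
  simp only [orbitAverage, Measure.smul_apply, smul_eq_mul, Measure.finsetSum_apply]
  congr 1
  exact Finset.sum_congr rfl fun j _ => Measure.map_apply (hf.iterate j).measurable hA

theorem orbitAverage_le {f : X → X} (hf : Continuous f) {m lam : Measure X}
    (h : ∀ j, ∀ A, MeasurableSet A → m (f^[j] ⁻¹' A) ≤ lam A) (n : ℕ) :
    orbitAverage f m n ≤ lam := by
  refine Measure.le_iff.2 fun A hA => ?_
  rw [orbitAverage_apply hf m n hA]
  rcases Nat.eq_zero_or_pos n with rfl | hn
  · simp
  calc (n : ℝ≥0∞)⁻¹ * ∑ j ∈ Finset.range n, m (f^[j] ⁻¹' A)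
      ≤ (n : ℝ≥0∞)⁻¹ * ∑ j ∈ Finset.range n, lam A := by
        exact mul_le_mul_right (Finset.sum_le_sum fun j _ => h j A hA) _
    _ = lam A := by
        rw [Finset.sum_const, Finset.card_range, nsmul_eq_mul, ← mul_assoc,
          ENNReal.inv_mul_cancel (by simpa using hn.ne') (by simp), one_mul]

theorem isProbabilityMeasure_orbitAverage {f : X → X} (hf : Continuous f) (m : Measure X)
    [IsProbabilityMeasure m] {n : ℕ} (hn : n ≠ 0) : IsProbabilityMeasure (orbitAverage f m n) := by
  constructor
  rw [orbitAverage_apply hf m n MeasurableSet.univ]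
  simp [ENNReal.inv_mul_cancel, hn]

variable [CompactSpace X]

theorem integral_orbitAverage {f : X → X} (hf : Continuous f) (m : Measure X)
    [IsProbabilityMeasure m] (n : ℕ) (g : C(X, ℝ)) :
    ∫ x, g x ∂orbitAverage f m n = (n : ℝ)⁻¹ * ∑ j ∈ Finset.range n, ∫ x, g (f^[j] x) ∂m := by
  have hint : ∀ j, Integrable g (m.map f^[j]) := fun j => by
    have := Measure.isProbabilityMeasure_map (μ := m) (hf.iterate j).measurable.aemeasurable
    exact g.continuous.integrable_of_hasCompactSupport (HasCompactSupport.of_compactSpace _)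
  rw [orbitAverage, integral_smul_measure, integral_finsetSum_measure fun j _ => hint j]
  simp only [ENNReal.toReal_inv, ENNReal.toReal_natCast, smul_eq_mul]
  congr 1
  refine Finset.sum_congr rfl fun j _ => ?_
  rw [integral_map (hf.iterate j).measurable.aemeasurable
    g.continuous.aestronglyMeasurable]

/-- Weak* accumulation points of the averages are invariant. -/
theorem measurePreserving_of_isWeakStarAccPt {f : X → X} (hf : Continuous f) (m : Measure X)
    [IsProbabilityMeasure m] (μ : Measure X) [IsProbabilityMeasure μ]
    (h : HyperbolicTimes.IsWeakStarAccPt (orbitAverage f m) μ) : MeasurePreserving f μ μ := by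
  obtain ⟨φ, hφ, hlim⟩ := h
  refine ⟨hf.measurable, ?_⟩
  have := Measure.isProbabilityMeasure_map (μ := μ) hf.measurable.aemeasurable
  refine ext_of_forall_integral_eq_of_IsFiniteMeasure fun g => ?_
  rw [integral_map hf.measurable.aemeasurable g.continuous.aestronglyMeasurable]
  let g' : C(X, ℝ) := g.toContinuousMap
  let gf : C(X, ℝ) := g'.comp ⟨f, hf⟩
  have h1 := hlim gf
  have h2 := hlim g'
  have hdiff : Tendsto (fun k => ∫ x, gf x ∂orbitAverage f m (φ k) -
      ∫ x, g' x ∂orbitAverage f m (φ k)) atTop (𝓝 0) := by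
    have hb : ∀ n, |∫ x, gf x ∂orbitAverage f m n - ∫ x, g' x ∂orbitAverage f m n| ≤
        2 * ‖g‖ * (n : ℝ)⁻¹ := by
      intro n
      rw [integral_orbitAverage hf, integral_orbitAverage hf, ← mul_sub,
        ← Finset.sum_sub_distrib]
      -- The difference of the two averages telescopes to two boundary terms, of total size at most
      -- 2‖g‖/n.
      have htel : ∀ j, ∫ x, gf (f^[j] x) ∂m = ∫ x, g' (f^[j + 1] x) ∂m := by
        intro j; simp only [Function.iterate_succ_apply']; rfl
      simp only [htel]
      rw [Finset.sum_range_sub (fun j => ∫ x, g' (f^[j] x) ∂m), abs_mul, mul_comm,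
        abs_of_nonneg (by positivity : (0 : ℝ) ≤ (n : ℝ)⁻¹)]
      gcongr
      have hbd : ∀ j, |∫ x, g' (f^[j] x) ∂m| ≤ ‖g‖ := by
        intro j
        refine (norm_integral_le_of_norm_le_const (C := ‖g‖)
          (ae_of_all _ fun x => g.norm_coe_le_norm _)).trans ?_
        simp
      refine (abs_sub _ _).trans ?_
      linarith [hbd n, hbd 0]
    refine squeeze_zero_norm (fun k => hb (φ k)) ?_
    have : Tendsto (fun k => (φ k : ℝ)⁻¹) atTop (𝓝 0) :=
      tendsto_inv_atTop_zero.comp (tendsto_natCast_atTop_atTop.comp hφ.tendsto_atTop)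
    simpa using this.const_mul (2 * ‖g‖)
  have h3 := tendsto_nhds_unique (h1.sub h2) hdiff
  exact sub_eq_zero.1 h3

/-- On open sets the bound survives the limit by the portmanteau theorem; outer regularity of `lam`
carries it to all Borel sets. -/
theorem IsWeakStarAccPt.le_of_le {ν : ℕ → Measure X}
    (hν : ∀ n ≠ 0, IsProbabilityMeasure (ν n)) {μ lam : Measure X} [IsProbabilityMeasure μ]
    [IsFiniteMeasure lam] (hle : ∀ n, ν n ≤ lam)
    (h : HyperbolicTimes.IsWeakStarAccPt ν μ) : μ ≤ lam := by
  obtain ⟨φ, hφ, hlim⟩ := h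
  -- The index is shifted because `φ 0` may be 0, where `ν` need not be a probability measure.
  have hφ0 : ∀ k, φ (k + 1) ≠ 0 := fun k => by
    have := hφ (Nat.lt_succ_self k); simp only [Nat.succ_eq_add_one] at this; omega
  let P : ℕ → ProbabilityMeasure X := fun k => ⟨ν (φ (k + 1)), hν _ (hφ0 k)⟩
  let μ' : ProbabilityMeasure X := ⟨μ, inferInstance⟩
  have hP : Tendsto P atTop (𝓝 μ') := by
    rw [ProbabilityMeasure.tendsto_iff_forall_integral_tendsto]
    intro g
    exact (hlim g.toContinuousMap).comp (tendsto_add_atTop_nat 1)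
  have hopen : ∀ G : Set X, IsOpen G → μ G ≤ lam G := by
    intro G hG
    have := ProbabilityMeasure.le_liminf_measure_open_of_tendsto hP hG
    refine this.trans ?_
    refine (liminf_le_liminf (Eventually.of_forall fun k => hle (φ (k + 1)) G)).trans ?_
    simp
  refine Measure.le_iff.2 fun A _ => ?_
  rw [A.measure_eq_iInf_isOpen lam]
  exact le_iInf₂ fun U hAU => le_iInf fun hU => (measure_mono hAU).trans (hopen U hU)

theorem exists_isWeakStarAccPt {ν : ℕ → Measure X} (hν : ∀ n ≠ 0, IsProbabilityMeasure (ν n)) :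
    ∃ μ : Measure X, IsProbabilityMeasure μ ∧ HyperbolicTimes.IsWeakStarAccPt ν μ := by
  let P : ℕ → ProbabilityMeasure X := fun k => ⟨ν (k + 1), hν _ (Nat.succ_ne_zero k)⟩
  obtain ⟨μ, φ, hφ, hlim⟩ := CompactSpace.tendsto_subseq P
  refine ⟨μ, inferInstance, fun k => φ k + 1, fun a b hab => by simpa using hφ hab, fun g => ?_⟩
  rw [ProbabilityMeasure.tendsto_iff_forall_integral_tendsto] at hlim
  exact hlim (BoundedContinuousFunction.mkOfCompact g)

end Averages

/-! ### From an integrable first marked time to a dominating measure. -/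

section ReturnTimes

open Set

variable {X : Type*} [MetricSpace X] [MeasurableSpace X] [BorelSpace X]

/-- If points are marked at certain times `n` (they belong to `H n`), consistently along orbits, if
the first marked time is integrable, and if the restrictions of `m` to `H n` have images under
`f^n` with bounded densities, then the images of `m` are dominated by a single absolutely
continuous finite measure. -/
theorem exists_dominating_measure {f : X → X} (hf : Continuous f) (m : Measure X)
    (hns : ∀ A, MeasurableSet A → m A = 0 → m (f ⁻¹' A) = 0) (H : ℕ → Set X)
    (hH : ∀ n, MeasurableSet (H n)) (hH0 : H 0 = univ)
    (hadd : ∀ i k x, x ∈ H i → f^[i] x ∈ H k → x ∈ H (i + k)) {C : ℝ≥0∞} (hC : C ≠ ⊤)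
    (hdens : ∀ n A, MeasurableSet A → m (H n ∩ f^[n] ⁻¹' A) ≤ C * m A)
    (hint : ∫⁻ x, ((⨅ n ∈ {n : ℕ | 1 ≤ n ∧ x ∈ H n}, (n : ℕ∞) : ℕ∞) : ℝ≥0∞) ∂m < ⊤) :
    ∃ lam : Measure X, IsFiniteMeasure lam ∧ lam ≪ m ∧
      ∀ j, ∀ A, MeasurableSet A → m (f^[j] ⁻¹' A) ≤ lam A := by
  -- `T l` is where the first marked time exceeds `l`, so the indicators of the `T l`, starting at l
  -- = 0, sum to at most that time.
  let T : ℕ → Set X := fun l => {x | ∀ n, 1 ≤ n → n ≤ l → x ∉ H n}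
  have hT : ∀ l, MeasurableSet (T l) := by
    intro l
    have : T l = ⋂ n, ⋂ (_ : 1 ≤ n), ⋂ (_ : n ≤ l), (H n)ᶜ := by ext; simp [T]
    rw [this]
    exact MeasurableSet.iInter fun n => MeasurableSet.iInter fun _ => MeasurableSet.iInter fun _ =>
      (hH n).compl
  have hit : ∀ n, Measurable f^[n] := fun n => (hf.iterate n).measurable
  have hns' : ∀ n A, MeasurableSet A → m A = 0 → m (f^[n] ⁻¹' A) = 0 := by
    intro n
    induction n with
    | zero => intro A _ h; simpa using h
    | succ n ih =>
      intro A hA h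
      rw [Function.iterate_succ, preimage_comp]
      exact hns _ (hit n hA) (ih A hA h)
  let ν : Measure X := Measure.sum fun l => (m.restrict (T l)).map f^[l]
  have hν : ∀ A, MeasurableSet A → ν A = ∑' l, m (f^[l] ⁻¹' A ∩ T l) := by
    intro A hA
    rw [Measure.sum_apply _ hA]
    congr 1; ext l
    rw [Measure.map_apply (hit l) hA, Measure.restrict_apply (hit l hA)]
  have hsum : ∀ x, ∑' l, (T l).indicator (fun _ => (1 : ℝ≥0∞)) x ≤
      ((⨅ n ∈ {n : ℕ | 1 ≤ n ∧ x ∈ H n}, (n : ℕ∞) : ℕ∞) : ℝ≥0∞) := by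
    intro x
    set N := (⨅ n ∈ {n : ℕ | 1 ≤ n ∧ x ∈ H n}, (n : ℕ∞) : ℕ∞) with hN
    by_cases hex : ∃ n, 1 ≤ n ∧ x ∈ H n
    · classical
      have hNn : ((Nat.find hex : ℕ) : ℕ∞) ≤ N := by
        rw [hN]
        refine le_iInf₂ fun n hn => ?_
        exact_mod_cast Nat.find_min' hex hn
      have hle : ((Nat.find hex : ℕ) : ℝ≥0∞) ≤ (N : ℝ≥0∞) := by
        have := ENat.toENNReal_le.2 hNn
        simpa using this
      refine le_trans ?_ hle
      rw [tsum_eq_sum (s := Finset.range (Nat.find hex))]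
      · refine (Finset.sum_le_card_nsmul _ _ 1 fun l _ => ?_).trans (by simp)
        exact indicator_le_self' (fun _ _ => zero_le) x
      · intro l hl
        rw [Finset.mem_range, not_lt] at hl
        refine indicator_of_notMem (fun h => ?_) _
        exact h _ (Nat.find_spec hex).1 hl (Nat.find_spec hex).2
    · have : N = ⊤ := by
        rw [hN]; simp only [iInf_eq_top]
        intro n hn; exact absurd ⟨n, hn⟩ hex
      simp [this]
  have hfin : IsFiniteMeasure ν := by
    constructor
    rw [hν _ MeasurableSet.univ]
    refine lt_of_le_of_lt ?_ hint
    refine le_trans (le_of_eq ?_) (lintegral_mono hsum)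
    rw [lintegral_tsum fun l => (measurable_const.indicator (hT l)).aemeasurable]
    congr 1; ext l
    rw [lintegral_indicator (hT l)]
    simp
  refine ⟨C • ν, ?_, ?_, ?_⟩
  · exact ⟨by
      rw [Measure.smul_apply, smul_eq_mul]
      exact ENNReal.mul_lt_top hC.lt_top (measure_lt_top ν _)⟩
  · refine Measure.AbsolutelyContinuous.mk fun A hA h => ?_
    rw [Measure.smul_apply, hν A hA, smul_eq_mul]
    have : ∀ l, m (f^[l] ⁻¹' A ∩ T l) = 0 := fun l =>
      measure_mono_null inter_subset_left (hns' l A hA h)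
    simp [this]
  · intro j A hA
    -- Here `i` is the last marked time up to `j`; it exists since 0 is marked. By `hadd`, a mark of
    -- `f^[i] x` within the remaining `j - i` steps would give a later one for `x`.
    have hcover : f^[j] ⁻¹' A ⊆ ⋃ i ∈ Finset.range (j + 1),
        H i ∩ f^[i] ⁻¹' (f^[j - i] ⁻¹' A ∩ T (j - i)) := by
      intro x hx
      classical
      let i := Nat.findGreatest (fun i => x ∈ H i) j
      have hij : i ≤ j := Nat.findGreatest_le j
      have hi : x ∈ H i :=
        Nat.findGreatest_spec (P := fun i => x ∈ H i) (Nat.zero_le j) (by rw [hH0]; trivial)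
      refine mem_biUnion (x := i) (by simp; omega) ⟨hi, ?_, ?_⟩
      · change f^[j - i] (f^[i] x) ∈ A
        rw [← Function.iterate_add_apply, Nat.sub_add_cancel hij]
        exact hx
      · intro n hn1 hn2 hn
        have := Nat.findGreatest_is_greatest (P := fun i => x ∈ H i) (k := i + n) (n := j)
          (show i < i + n by omega) (by omega)
        exact this (hadd _ _ _ hi hn)
    rw [Measure.smul_apply, smul_eq_mul, hν A hA]
    calc m (f^[j] ⁻¹' A) ≤ ∑ i ∈ Finset.range (j + 1),
          m (H i ∩ f^[i] ⁻¹' (f^[j - i] ⁻¹' A ∩ T (j - i))) :=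
          (measure_mono hcover).trans (measure_biUnion_finset_le _ _)
      _ ≤ ∑ i ∈ Finset.range (j + 1), C * m (f^[j - i] ⁻¹' A ∩ T (j - i)) := by
          gcongr with i _
          exact hdens i _ ((hit _ hA).inter (hT _))
      _ = C * ∑ i ∈ Finset.range (j + 1), m (f^[i] ⁻¹' A ∩ T i) := by
          rw [← Finset.mul_sum]
          congr 1
          have := Finset.sum_range_reflect (fun i => m (f^[i] ⁻¹' A ∩ T i)) (j + 1)
          simpa using this
      _ ≤ _ := by gcongr; exact ENNReal.sum_le_tsum _

theorem exists_absolutelyContinuous_of_dominating [CompactSpace X] {f : X → X}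
    (hf : Continuous f) (m : Measure X) [IsProbabilityMeasure m] {lam : Measure X} [IsFiniteMeasure lam] (hlam : lam ≪ m)
    (hle : ∀ j, ∀ A, MeasurableSet A → m (f^[j] ⁻¹' A) ≤ lam A) :
    (∃ μ : Measure X, IsProbabilityMeasure μ ∧ MeasurePreserving f μ μ ∧ μ ≪ m) ∧
    ∀ μ : Measure X, IsProbabilityMeasure μ →
      HyperbolicTimes.IsWeakStarAccPt (orbitAverage f m) μ →
      MeasurePreserving f μ μ ∧ μ ≪ m := by
  have hprob : ∀ n ≠ 0, IsProbabilityMeasure (orbitAverage f m n) := fun n hn =>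
    isProbabilityMeasure_orbitAverage hf m hn
  have main : ∀ μ : Measure X, IsProbabilityMeasure μ →
      HyperbolicTimes.IsWeakStarAccPt (orbitAverage f m) μ → MeasurePreserving f μ μ ∧ μ ≪ m :=
    fun μ _ h => ⟨measurePreserving_of_isWeakStarAccPt hf m μ h,
      (Measure.absolutelyContinuous_of_le
        (IsWeakStarAccPt.le_of_le hprob (orbitAverage_le hf hle) h)).trans hlam⟩
  obtain ⟨μ, hμ, hacc⟩ := exists_isWeakStarAccPt hprob
  exact ⟨⟨μ, hμ, main μ hμ hacc⟩, main⟩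

end ReturnTimes

/-! ### Continuity of the Riemannian norm of the derivative. -/

section RiemannianNorms

variable {E : Type*} [NormedAddCommGroup E] [NormedSpace ℝ E]
  {H : Type*} [TopologicalSpace H] {I : ModelWithCorners ℝ E H}
  {M : Type*} [TopologicalSpace M] [ChartedSpace H M]
  [RiemannianBundle (fun x : M => TangentSpace I x)]
  [IsManifold I 1 M] [IsContinuousRiemannianBundle E (fun x : M => TangentSpace I x)]
  {E' : Type*} [NormedAddCommGroup E'] [NormedSpace ℝ E']
  {H' : Type*} [TopologicalSpace H'] {I' : ModelWithCorners ℝ E' H'}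
  {M' : Type*} [TopologicalSpace M'] [ChartedSpace H' M']
  [RiemannianBundle (fun x : M' => TangentSpace I' x)]
  [IsManifold I' 1 M'] [IsContinuousRiemannianBundle E' (fun x : M' => TangentSpace I' x)]

/-- The operators act between varying fibres. Trivializations carry them to operators `N y` between
the fixed fibres over `x` and `g x`, which vary continuously, and they distort norms by factors as
close to 1 as desired near `x`. -/
theorem ContMDiffAt.continuousAt_norm_mfderiv {g : M → M'} {x : M}
    (hg : ContMDiffAt I I' 1 g x) : ContinuousAt (fun y => ‖mfderiv I I' g y‖) x := by
  have hA := (hg.mfderiv_const (m := 0) (by simp)).continuousAt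
  let V : M → Type _ := fun x => TangentSpace I x
  let V' : M' → Type _ := fun x => TangentSpace I' x
  set T := trivializationAt E V x
  set T' := trivializationAt E' V' (g x)
  let A : M → (E →L[ℝ] E') := fun y =>
    (T'.continuousLinearMapAt ℝ (g y)) ∘L (mfderiv I I' g y) ∘L (T.symmL ℝ y)
  have hA' : ContinuousAt A x := hA
  let N : M → (TangentSpace I x →L[ℝ] TangentSpace I' (g x)) := fun y =>
    (T'.symmL ℝ (g x)) ∘L (A y) ∘L (T.continuousLinearMapAt ℝ x)
  have hN : ContinuousAt N x := by
    have : Continuous fun B : E →L[ℝ] E' =>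
        (T'.symmL ℝ (g x)) ∘L B ∘L (T.continuousLinearMapAt ℝ x) :=
      continuous_const.clm_comp (continuous_id.clm_comp continuous_const)
    exact this.continuousAt.comp hA'
  have hx : x ∈ T.baseSet := FiberBundle.mem_baseSet_trivializationAt' x
  have hx' : g x ∈ T'.baseSet := FiberBundle.mem_baseSet_trivializationAt' (g x)
  have hb : ∀ᶠ y in 𝓝 x, y ∈ T.baseSet := T.open_baseSet.mem_nhds hx
  have hb' : ∀ᶠ y in 𝓝 x, g y ∈ T'.baseSet :=
    hg.continuousAt.preimage_mem_nhds (T'.open_baseSet.mem_nhds hx')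
  have eN : ∀ y, N y = ((T'.symmL ℝ (g x)) ∘L (T'.continuousLinearMapAt ℝ (g y))) ∘L
      (mfderiv I I' g y) ∘L ((T.symmL ℝ y) ∘L (T.continuousLinearMapAt ℝ x)) := fun y => rfl
  have eD : ∀ y, y ∈ T.baseSet → g y ∈ T'.baseSet → mfderiv I I' g y =
      ((T'.symmL ℝ (g y)) ∘L (T'.continuousLinearMapAt ℝ (g x))) ∘L (N y) ∘L
        ((T.symmL ℝ x) ∘L (T.continuousLinearMapAt ℝ y)) := by
    intro y hy hy'
    ext v
    have h1 : T.symmL ℝ y (T.continuousLinearMapAt ℝ y v) = v :=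
      T.symmL_continuousLinearMapAt hy v
    have h2 : ∀ w, T.continuousLinearMapAt ℝ x (T.symmL ℝ x w) = w :=
      T.continuousLinearMapAt_symmL hx
    have h3 : ∀ w, T'.continuousLinearMapAt ℝ (g x) (T'.symmL ℝ (g x) w) = w :=
      T'.continuousLinearMapAt_symmL hx'
    have h4 : ∀ w, T'.symmL ℝ (g y) (T'.continuousLinearMapAt ℝ (g y) w) = w :=
      T'.symmL_continuousLinearMapAt hy'
    simp only [N, A, ContinuousLinearMap.comp_apply, h1, h2, h3, h4]
  have hbound : ∀ r : ℝ, 1 < r → ∀ᶠ y in 𝓝 x,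
      ‖mfderiv I I' g y‖ ≤ r * ‖N y‖ * r ∧ ‖N y‖ ≤ r * ‖mfderiv I I' g y‖ * r := by
    intro r hr
    filter_upwards [hb, hb', eventually_norm_symmL_trivializationAt_self_comp_lt E V x hr,
      eventually_norm_symmL_trivializationAt_comp_self_lt E V x hr,
      hg.continuousAt.eventually
        (eventually_norm_symmL_trivializationAt_self_comp_lt E' V' (g x) hr),
      hg.continuousAt.eventually
        (eventually_norm_symmL_trivializationAt_comp_self_lt E' V' (g x) hr)]
      with y hy hy' h1 h2 h3 h4
    constructor
    · rw [eD y hy hy']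
      refine (ContinuousLinearMap.opNorm_comp_le _ _).trans ?_
      rw [mul_assoc]
      refine mul_le_mul h4.le ((ContinuousLinearMap.opNorm_comp_le _ _).trans ?_) (norm_nonneg _)
        (by linarith)
      exact mul_le_mul_of_nonneg_left h1.le (norm_nonneg _)
    · rw [eN y]
      refine (ContinuousLinearMap.opNorm_comp_le _ _).trans ?_
      rw [mul_assoc]
      refine mul_le_mul h3.le ((ContinuousLinearMap.opNorm_comp_le _ _).trans ?_) (norm_nonneg _)
        (by linarith)
      exact mul_le_mul_of_nonneg_left h2.le (norm_nonneg _)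
  have hNx : ‖N x‖ = ‖mfderiv I I' g x‖ := by
    have lim : ∀ a : ℝ, Tendsto (fun r : ℝ => r * a * r) (𝓝[>] 1) (𝓝 a) := by
      intro a
      have : Continuous fun r : ℝ => r * a * r := by fun_prop
      simpa using (this.tendsto 1).mono_left nhdsWithin_le_nhds
    apply le_antisymm
    · exact ge_of_tendsto (lim _)
        (eventually_nhdsWithin_of_forall fun r hr => ((hbound r hr).self_of_nhds).2)
    · exact ge_of_tendsto (lim _)
        (eventually_nhdsWithin_of_forall fun r hr => ((hbound r hr).self_of_nhds).1)
  have hNn : Tendsto (fun y => ‖N y‖) (𝓝 x) (𝓝 ‖mfderiv I I' g x‖) := by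
    rw [← hNx]
    exact Tendsto.comp (continuous_norm.tendsto (N x)) hN
  refine tendsto_order.2 ⟨fun c hc => ?_, fun c hc => ?_⟩
  · have : ∃ r : ℝ, 1 < r ∧ r * c * r < ‖mfderiv I I' g x‖ := by
      have hcont : Continuous fun r : ℝ => r * c * r := by fun_prop
      have h1 : ∀ᶠ r in 𝓝[>] (1 : ℝ), r * c * r < ‖mfderiv I I' g x‖ :=
        nhdsWithin_le_nhds ((hcont.tendsto 1).eventually_lt_const (by simpa using hc))
      exact (eventually_mem_nhdsWithin.and h1).exists
    obtain ⟨r, hr, hrc⟩ := this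
    filter_upwards [hbound r hr, hNn.eventually_const_lt hrc] with y hy1 hy2
    have h := hy2.trans_le hy1.2
    have hr0 : (0 : ℝ) < r := by linarith
    exact lt_of_mul_lt_mul_left (lt_of_mul_lt_mul_right h hr0.le) hr0.le
  · have : ∃ r : ℝ, 1 < r ∧ r * ‖mfderiv I I' g x‖ * r < c := by
      have hcont : Continuous fun r : ℝ => r * ‖mfderiv I I' g x‖ * r := by fun_prop
      have h1 : ∀ᶠ r in 𝓝[>] (1 : ℝ), r * ‖mfderiv I I' g x‖ * r < c :=
        nhdsWithin_le_nhds ((hcont.tendsto 1).eventually_lt_const (by simpa using hc))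
      exact (eventually_mem_nhdsWithin.and h1).exists
    obtain ⟨r, hr, hrc⟩ := this
    have hlim : Tendsto (fun y => r * ‖N y‖ * r) (𝓝 x) (𝓝 (r * ‖mfderiv I I' g x‖ * r)) :=
      (hNn.const_mul r).mul_const r
    filter_upwards [hbound r hr, hlim.eventually_lt_const hrc] with y hy1 hy2
    exact hy1.1.trans_lt hy2

end RiemannianNorms

/-! ### Derivative bounds give local Lipschitz bounds for the distance. -/

section LocallyLipschitz

open Metric Set Manifold

variable {E : Type*} [NormedAddCommGroup E] [NormedSpace ℝ E]
  {H : Type*} [TopologicalSpace H] {I : ModelWithCorners ℝ E H}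
  {M : Type*} [MetricSpace M] [ChartedSpace H M]
  [RiemannianBundle (fun x : M => TangentSpace I x)]
  [IsManifold I 1 M] [IsContinuousRiemannianBundle E (fun x : M => TangentSpace I x)]
  [IsRiemannianManifold I M]
  {E' : Type*} [NormedAddCommGroup E'] [NormedSpace ℝ E']
  {H' : Type*} [TopologicalSpace H'] {I' : ModelWithCorners ℝ E' H'}
  {M' : Type*} [MetricSpace M'] [ChartedSpace H' M']
  [RiemannianBundle (fun x : M' => TangentSpace I' x)]
  [IsManifold I' 1 M'] [IsContinuousRiemannianBundle E' (fun x : M' => TangentSpace I' x)]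
  [IsRiemannianManifold I' M']

/-- A map between Riemannian manifolds that is `C^1` at a point is locally Lipschitz there, with
any constant larger than the norm of its derivative. -/
theorem ContMDiffAt.exists_nhds_dist_le {g : M → M'} {x : M}
    (hg : ContMDiffAt I I' 1 g x) {c : ℝ} (hc : ‖mfderiv I I' g x‖ < c) :
    ∃ U ∈ 𝓝 x, ∀ u ∈ U, ∀ v ∈ U, dist (g u) (g v) ≤ c * dist u v := by
  have hc0 : 0 ≤ c := (ContinuousLinearMap.opNorm_nonneg _).trans hc.le
  have hev : ∀ᶠ y in 𝓝 x, ContMDiffAt I I' 1 g y ∧ ‖mfderiv I I' g y‖ < c :=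
    ((contMDiffAt_iff_contMDiffAt_nhds (by simp)).1 hg).and
      (hg.continuousAt_norm_mfderiv.eventually_lt_const hc)
  obtain ⟨r, hr, hball⟩ := Metric.mem_nhds_iff.1 hev
  -- From a point of this ball, a curve of length below 2r/3 cannot leave `ball x r`, where the
  -- derivative is controlled.
  refine ⟨ball x (r / 3), ball_mem_nhds _ (by positivity), fun u hu v hv => ?_⟩
  have huv : dist u v < 2 * r / 3 := by
    have := dist_triangle_right u v x
    rw [mem_ball] at hu hv
    linarith
  have key : ∀ R, dist u v < R → R < 2 * r / 3 → dist (g u) (g v) ≤ c * R := by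
    intro R hR1 hR2
    have hR0 : 0 < R := dist_nonneg.trans_lt hR1
    have hlt : riemannianEDist I u v < ENNReal.ofReal R := by
      rw [← IsRiemannianManifold.out (I := I) u v, edist_dist]
      exact (ENNReal.ofReal_lt_ofReal_iff hR0).2 hR1
    obtain ⟨γ, hγ0, hγ1, hγ, hlen⟩ := exists_lt_of_riemannianEDist_lt hlt
    have hmem : ∀ t ∈ Icc (0 : ℝ) 1, γ t ∈ ball x r := by
      intro t ht
      have h1 : edist u (γ t) < ENNReal.ofReal R := by
        rw [IsRiemannianManifold.out (I := I) u (γ t)]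
        refine (riemannianEDist_le_pathELength (hγ.mono (Icc_subset_Icc le_rfl ht.2)) hγ0 rfl
          ht.1).trans_lt ((pathELength_mono le_rfl ht.2).trans_lt hlen)
      rw [edist_dist, ENNReal.ofReal_lt_ofReal_iff hR0] at h1
      rw [mem_ball] at hu ⊢
      have := dist_triangle_left (γ t) x u
      linarith
    have hcomp : ContMDiffOn 𝓘(ℝ, ℝ) I' 1 (g ∘ γ) (Icc 0 1) := fun t ht =>
      (hball (hmem t ht)).1.comp_contMDiffWithinAt t (hγ t ht)
    have hle : edist (g u) (g v) ≤ ENNReal.ofReal c * ENNReal.ofReal R := by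
      rw [IsRiemannianManifold.out (I := I') (g u) (g v)]
      refine (riemannianEDist_le_pathELength hcomp (by simp [hγ0]) (by simp [hγ1])
        zero_le_one).trans ?_
      refine le_trans ?_ (mul_le_mul_right hlen.le _)
      rw [pathELength_eq_lintegral_mfderivWithin_Icc, pathELength_eq_lintegral_mfderivWithin_Icc,
        ← lintegral_const_mul' _ _ ENNReal.ofReal_ne_top]
      refine setLIntegral_mono' measurableSet_Icc fun t ht => ?_
      have hd : mfderivWithin 𝓘(ℝ, ℝ) I' (g ∘ γ) (Icc 0 1) t =
          (mfderiv I I' g (γ t)) ∘L (mfderivWithin 𝓘(ℝ, ℝ) I γ (Icc 0 1) t) := by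
        apply mfderiv_comp_mfderivWithin
        · exact (hball (hmem t ht)).1.mdifferentiableAt one_ne_zero
        · exact (hγ t ht).mdifferentiableWithinAt one_ne_zero
        · rw [uniqueMDiffWithinAt_iff_uniqueDiffWithinAt]
          exact uniqueDiffOn_Icc zero_lt_one t ht
      rw [hd]
      have h2 := (mfderiv I I' g (γ t)).le_opNorm (mfderivWithin 𝓘(ℝ, ℝ) I γ (Icc 0 1) t 1)
      have h3 := h2.trans (mul_le_mul_of_nonneg_right (hball (hmem t ht)).2.le (norm_nonneg _))
      rw [← ofReal_norm, ← ofReal_norm, ← ENNReal.ofReal_mul hc0]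
      exact ENNReal.ofReal_le_ofReal h3
    rw [edist_dist, ← ENNReal.ofReal_mul hc0] at hle
    exact (ENNReal.ofReal_le_ofReal_iff (by positivity)).1 hle
  have hlim : Tendsto (fun R => c * R) (𝓝[>] (dist u v)) (𝓝 (c * dist u v)) :=
    ((continuous_const.mul continuous_id).tendsto _).mono_left nhdsWithin_le_nhds
  refine ge_of_tendsto hlim ?_
  filter_upwards [Ioo_mem_nhdsGT huv] with R hR using key R hR.1 hR.2

end LocallyLipschitz

theorem isContinuousRiemannianBundle_of_isContMDiffRiemannianBundle
    {EB : Type*} [NormedAddCommGroup EB] [NormedSpace ℝ EB]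
    {HB : Type*} [TopologicalSpace HB] (IB : ModelWithCorners ℝ EB HB) (n : WithTop ℕ∞)
    {B : Type*} [TopologicalSpace B] [ChartedSpace HB B]
    {F : Type*} [NormedAddCommGroup F] [NormedSpace ℝ F]
    {V : B → Type*} [TopologicalSpace (TotalSpace F V)] [∀ x, NormedAddCommGroup (V x)]
    [∀ x, InnerProductSpace ℝ (V x)] [FiberBundle F V] [VectorBundle ℝ F V]
    [h : IsContMDiffRiemannianBundle IB n F V] : IsContinuousRiemannianBundle F V := by
  obtain ⟨g, hg, hg'⟩ := h.exists_contMDiff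
  exact ⟨g, hg.continuous, hg'⟩

/-! ### Charts, short paths and inverse derivatives on the manifold. -/

section LocalDiffeo

set_option linter.unusedSectionVars false

open Metric Set

variable {d : ℕ} {M : Type*} [MetricSpace M] [ChartedSpace (EuclideanSpace ℝ (Fin d)) M]
  [IsManifold (𝓡 d) ∞ M] [RiemannianBundle (fun x : M => TangentSpace (𝓡 d) x)]
  [IsContMDiffRiemannianBundle (𝓡 d) ∞ (EuclideanSpace ℝ (Fin d))
    (fun x : M => TangentSpace (𝓡 d) x)]
  [IsRiemannianManifold (𝓡 d) M]

instance : IsContinuousRiemannianBundle (EuclideanSpace ℝ (Fin d))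
    (fun x : M => TangentSpace (𝓡 d) x) :=
  isContinuousRiemannianBundle_of_isContMDiffRiemannianBundle (𝓡 d) ∞

instance : IsContinuousRiemannianBundle (EuclideanSpace ℝ (Fin d))
    (fun x : EuclideanSpace ℝ (Fin d) => TangentSpace (𝓡 d) x) :=
  isContinuousRiemannianBundle_of_isContMDiffRiemannianBundle (𝓡 d) ω

theorem exists_nhds_dist_chartAt_le (p : M) {x : M}
    (hx : x ∈ (chartAt (EuclideanSpace ℝ (Fin d)) p).source) :
    ∃ c : ℝ, ∃ U ∈ 𝓝 x, ∀ u ∈ U, ∀ v ∈ U,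
      dist (chartAt (EuclideanSpace ℝ (Fin d)) p u) (chartAt (EuclideanSpace ℝ (Fin d)) p v)
        ≤ c * dist u v := by
  have h : ContMDiffAt (𝓡 d) (𝓡 d) 1 (chartAt (EuclideanSpace ℝ (Fin d)) p) x :=
    (contMDiffOn_chart (I := 𝓡 d) (n := 1) (x := p)).contMDiffAt
      ((chartAt _ p).open_source.mem_nhds hx)
  exact ⟨_, h.exists_nhds_dist_le (lt_add_one _)⟩

theorem exists_nhds_dist_chartAt_symm_le (p : M) {y : EuclideanSpace ℝ (Fin d)}
    (hy : y ∈ (chartAt (EuclideanSpace ℝ (Fin d)) p).target) :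
    ∃ c : ℝ, ∃ U ∈ 𝓝 y, ∀ u ∈ U, ∀ v ∈ U,
      dist ((chartAt (EuclideanSpace ℝ (Fin d)) p).symm u)
        ((chartAt (EuclideanSpace ℝ (Fin d)) p).symm v) ≤ c * dist u v := by
  have h : ContMDiffAt (𝓡 d) (𝓡 d) 1 (chartAt (EuclideanSpace ℝ (Fin d)) p).symm y :=
    (contMDiffOn_chart_symm (I := 𝓡 d) (n := 1) (x := p)).contMDiffAt
      ((chartAt _ p).open_target.mem_nhds hy)
  exact ⟨_, h.exists_nhds_dist_le (lt_add_one _)⟩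

/-- Small chart balls have short paths. -/
theorem exists_hasShortPaths (d : ℕ) {M : Type*} [MetricSpace M]
    [ChartedSpace (EuclideanSpace ℝ (Fin d)) M]
    [IsManifold (𝓡 d) ∞ M] [RiemannianBundle (fun x : M => TangentSpace (𝓡 d) x)]
    [IsContMDiffRiemannianBundle (𝓡 d) ∞ (EuclideanSpace ℝ (Fin d))
      (fun x : M => TangentSpace (𝓡 d) x)]
    [IsRiemannianManifold (𝓡 d) M] {ρ : ℝ} (hρ : 0 < ρ) (p : M) :
    ∃ U : Set M, p ∈ U ∧ IsOpen U ∧ IsPreconnected U ∧ HasShortPaths ρ U := by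
  set e := chartAt (EuclideanSpace ℝ (Fin d)) p with he
  obtain ⟨c, W, hW, hc⟩ := exists_nhds_dist_chartAt_symm_le (d := d) p
    (mem_chart_target _ p)
  obtain ⟨r, hr, hball⟩ := Metric.mem_nhds_iff.1
    (inter_mem hW (e.open_target.mem_nhds (mem_chart_target _ p)))
  have hC : 0 < |c| + 1 := by positivity
  -- The images of segments in this ball are `ρ`-Lipschitz paths: the diameter is at most 2s and the
  -- inverse chart is (|c| + 1)-Lipschitz.
  set s := min r (ρ / (2 * (|c| + 1))) with hs
  have hs0 : 0 < s := lt_min hr (by positivity)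
  have hsr : ball (e p) s ⊆ ball (e p) r := ball_subset_ball (min_le_left _ _)
  have hst : ball (e p) s ⊆ e.target := fun y hy => (hball (hsr hy)).2
  have hmem : ∀ y ∈ e.symm '' ball (e p) s, e y ∈ ball (e p) s := by
    rintro _ ⟨y, hy, rfl⟩
    rwa [e.right_inv (hst hy)]
  have hinv : ∀ y ∈ e.symm '' ball (e p) s, e.symm (e y) = y := by
    rintro _ ⟨y, hy, rfl⟩
    rw [e.right_inv (hst hy)]
  have hsrc : ∀ y ∈ e.symm '' ball (e p) s, y ∈ e.source := by
    rintro _ ⟨y, hy, rfl⟩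
    exact e.map_target (hst hy)
  have hlip : ∀ u ∈ ball (e p) s, ∀ v ∈ ball (e p) s,
      dist (e.symm u) (e.symm v) ≤ (|c| + 1) * dist u v := by
    intro u hu v hv
    refine (hc u (hball (hsr hu)).1 v (hball (hsr hv)).1).trans ?_
    exact mul_le_mul_of_nonneg_right (by linarith [le_abs_self c]) dist_nonneg
  refine ⟨e.symm '' ball (e p) s, ⟨e p, mem_ball_self hs0, e.left_inv (mem_chart_source _ p)⟩,
    e.symm.isOpen_image_of_subset_source isOpen_ball hst,
    ((convex_ball _ _).isPreconnected).image _ (e.continuousOn_symm.mono hst), ?_⟩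
  rintro ⟨y, hy⟩
  have hseg : ∀ (t : unitInterval) (u : e.symm '' ball (e p) s),
      AffineMap.lineMap (e y) (e u) (t : ℝ) ∈ ball (e p) s := fun t u =>
    (convex_ball (e p) s).lineMap_mem (hmem y hy) (hmem u u.2) t.2
  refine ⟨⟨fun a => e.symm (AffineMap.lineMap (e y) (e a.2) (a.1 : ℝ)), ?_⟩, ?_, ?_, ?_, ?_⟩
  · refine (e.continuousOn_symm.mono hst).comp_continuous ?_ fun a => hseg _ _
    have h1 : Continuous fun u : e.symm '' ball (e p) s => e u :=
      e.continuousOn.comp_continuous continuous_subtype_val fun u => hsrc u u.2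
    have h2 : Continuous fun a : unitInterval × (e.symm '' ball (e p) s) => e a.2 :=
      h1.comp continuous_snd
    simp only [AffineMap.lineMap_apply_module]
    exact ((continuous_const.sub (continuous_subtype_val.comp continuous_fst)).smul
      continuous_const).add ((continuous_subtype_val.comp continuous_fst).smul h2)
  · intro u; simpa using hinv y hy
  · intro u; simpa using hinv u u.2
  · intro t; simpa using hinv y hy
  · intro t t' u
    refine (hlip _ (hseg t u) _ (hseg t' u)).trans ?_
    rw [dist_lineMap_lineMap, Real.dist_eq]
    have hd : dist (e y) (e u) ≤ 2 * s := by
      have h1 := mem_ball.1 (hmem y hy)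
      have h2 := mem_ball.1 (hmem u u.2)
      linarith [dist_triangle_right (e y) (e u) (e p)]
    have h3 : (|c| + 1) * dist (e y) (e u) ≤ ρ := by
      have h4 : s ≤ ρ / (2 * (|c| + 1)) := min_le_right _ _
      rw [le_div_iff₀ (by positivity)] at h4
      nlinarith
    calc (|c| + 1) * (|(t : ℝ) - t'| * dist (e y) (e u))
        = ((|c| + 1) * dist (e y) (e u)) * |(t : ℝ) - t'| := by ring
      _ ≤ _ := mul_le_mul_of_nonneg_right h3 (abs_nonneg _)

open HyperbolicTimes

theorem IsLocalDiffeomorphAt.of_mem_localInverse_target {f : M → M} {x : M}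
    (hf : IsLocalDiffeomorphAt (𝓡 d) (𝓡 d) 2 f x) {y : M} (hy : y ∈ hf.localInverse.target) :
    IsLocalDiffeomorphAt (𝓡 d) (𝓡 d) 2 f y :=
  ⟨hf.localInverse.symm, hy, hf.choose_spec.2⟩

/-- The equality of base points is only propositional, so `G ∘ L = id` does not typecheck between
tangent spaces; it is expressed in the common model space. -/
theorem norm_eq_norm_inverse {x z w : M}
    {L : TangentSpace (𝓡 d) x →L[ℝ] TangentSpace (𝓡 d) z} (hL : L.IsInvertible)
    {G : TangentSpace (𝓡 d) z →L[ℝ] TangentSpace (𝓡 d) w} (hw : w = x)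
    (h : ∀ v : EuclideanSpace ℝ (Fin d), (show EuclideanSpace ℝ (Fin d) from G (L v)) = v) :
    ‖G‖ = ‖L.inverse‖ := by
  subst hw
  obtain ⟨e, rfl⟩ := hL
  rw [ContinuousLinearMap.inverse_equiv]
  congr 1
  ext v
  obtain ⟨u, rfl⟩ := e.surjective v
  exact (h u).trans (e.symm_apply_apply u).symm

/-- A single local inverse serves all `y` near `x`. Thus ‖Df(y)⁻¹‖ is the derivative norm of a fixed
map, which yields both its continuity and the expansion estimate. -/
theorem norm_mfderiv_localInverse {f : M → M} {x : M}
    (hf : IsLocalDiffeomorphAt (𝓡 d) (𝓡 d) 2 f x) {y : M} (hy : y ∈ hf.localInverse.target) :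
    ‖mfderiv (𝓡 d) (𝓡 d) hf.localInverse (f y)‖ = invDerivNorm d f y := by
  have hfy := hf.of_mem_localInverse_target hy
  have hsrc : f y ∈ hf.localInverse.source := by
    rw [hf.choose_spec.2 hy]
    exact hf.localInverse.symm.map_source hy
  refine norm_eq_norm_inverse ⟨hfy.mfderivToContinuousLinearEquiv two_ne_zero,
    hfy.mfderivToContinuousLinearEquiv_coe _⟩ (hf.localInverse_left_inv hy) fun v => ?_
  have h1 := mfderiv_comp y (hf.localInverse.mdifferentiableAt two_ne_zero hsrc)
    (hfy.mdifferentiableAt two_ne_zero)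
  have h2 := (Filter.eventuallyEq_of_mem (hf.localInverse.open_target.mem_nhds hy)
      hf.localInverse_eqOn_left).mfderiv_eq (I := 𝓡 d) (I' := 𝓡 d)
  rw [h1, mfderiv_id] at h2
  exact DFunLike.congr_fun h2 v

theorem isLocallyExpandingAt_of_isLocalDiffeomorphAt {f : M → M} {x : M}
    (hf : IsLocalDiffeomorphAt (𝓡 d) (𝓡 d) 2 f x) {c : ℝ} (hc : invDerivNorm d f x < c) :
    IsLocallyExpandingAt f c x := by
  have hg : ContMDiffAt (𝓡 d) (𝓡 d) 1 hf.localInverse (f x) :=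
    hf.localInverse_contMDiffAt.of_le one_le_two
  obtain ⟨U, hU, hUc⟩ := hg.exists_nhds_dist_le (c := c)
    (by rwa [norm_mfderiv_localInverse hf hf.localInverse_mem_target])
  refine ⟨f ⁻¹' U ∩ hf.localInverse.target, inter_mem
    (hf.contMDiffAt.continuousAt.preimage_mem_nhds hU)
    (hf.localInverse.open_target.mem_nhds hf.localInverse_mem_target), fun u hu v hv => ?_⟩
  have := hUc _ hu.1 _ hv.1
  rwa [hf.localInverse_left_inv hu.2, hf.localInverse_left_inv hv.2] at this

theorem continuousAt_invDerivNorm {f : M → M} {x : M}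
    (hf : IsLocalDiffeomorphAt (𝓡 d) (𝓡 d) 2 f x) : ContinuousAt (invDerivNorm d f) x := by
  have hg : ContMDiffAt (𝓡 d) (𝓡 d) 1 hf.localInverse (f x) :=
    hf.localInverse_contMDiffAt.of_le one_le_two
  refine (hg.continuousAt_norm_mfderiv.comp hf.contMDiffAt.continuousAt).congr ?_
  filter_upwards [hf.localInverse.open_target.mem_nhds hf.localInverse_mem_target] with y hy
  exact norm_mfderiv_localInverse hf hy

theorem invDerivNorm_pos {f : M → M} {x : M} (hd : d ≠ 0)
    (hf : IsLocalDiffeomorphAt (𝓡 d) (𝓡 d) 2 f x) : 0 < invDerivNorm d f x := by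
  obtain ⟨e, he⟩ : (mfderiv (𝓡 d) (𝓡 d) f x).IsInvertible :=
    ⟨hf.mfderivToContinuousLinearEquiv two_ne_zero, hf.mfderivToContinuousLinearEquiv_coe _⟩
  have hnt : Nontrivial (EuclideanSpace ℝ (Fin d)) := by
    have : Nonempty (Fin d) := ⟨⟨0, Nat.pos_of_ne_zero hd⟩⟩
    infer_instance
  obtain ⟨v, hv⟩ := exists_ne (0 : EuclideanSpace ℝ (Fin d))
  rw [invDerivNorm, ← he, ContinuousLinearMap.inverse_equiv]
  refine (ContinuousLinearMap.opNorm_nonneg _).lt_of_ne fun h => hv ?_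
  have h0 := (ContinuousLinearMap.opNorm_zero_iff (f := (e.symm : TangentSpace (𝓡 d) (f x) →L[ℝ]
    TangentSpace (𝓡 d) x))).1 h.symm
  have h1 : e.symm (e v) = 0 := DFunLike.congr_fun h0 (e v)
  exact (e.symm_apply_apply v).symm.trans h1

end LocalDiffeo

/-! ### Gram determinants and the Jacobian in charts. -/

section Density

open Metric Set HyperbolicTimes

set_option linter.unusedSectionVars false

variable (d : ℕ) {M : Type*} [MetricSpace M] [ChartedSpace (EuclideanSpace ℝ (Fin d)) M]
  [IsManifold (𝓡 d) ∞ M] [RiemannianBundle (fun x : M => TangentSpace (𝓡 d) x)]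
  [IsContMDiffRiemannianBundle (𝓡 d) ∞ (EuclideanSpace ℝ (Fin d))
    (fun x : M => TangentSpace (𝓡 d) x)]
  [IsRiemannianManifold (𝓡 d) M]

/-- The Gram determinant of the coordinate vector fields of the preferred chart at `p`. -/
noncomputable def gramDet (p : M) (y : EuclideanSpace ℝ (Fin d)) : ℝ :=
  (Matrix.gram ℝ (fun i : Fin d => (mfderiv (𝓡 d) (𝓡 d)
    (chartAt (EuclideanSpace ℝ (Fin d)) p).symm y (EuclideanSpace.single i (1 : ℝ)) :
      TangentSpace (𝓡 d) ((chartAt (EuclideanSpace ℝ (Fin d)) p).symm y)))).det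

/-- The density of the Riemannian volume in the preferred chart at `p`. -/
noncomputable def chartDensity (p : M) (y : EuclideanSpace ℝ (Fin d)) : ℝ :=
  Real.sqrt (gramDet d p y)

theorem chartVolume_eq [MeasurableSpace M] (p : M) : chartVolume d M p =
    ((volume.restrict (chartAt (EuclideanSpace ℝ (Fin d)) p).target).withDensity
      fun y => ENNReal.ofReal (chartDensity d p y)).map
        (chartAt (EuclideanSpace ℝ (Fin d)) p).symm := rfl

theorem contDiffOn_gramDet (p : M) :
    ContDiffOn ℝ 1 (gramDet d p) (chartAt (EuclideanSpace ℝ (Fin d)) p).target := by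
  set e := chartAt (EuclideanSpace ℝ (Fin d)) p with he
  have hsec : ∀ v : EuclideanSpace ℝ (Fin d), ContMDiffOn (𝓡 d) ((𝓡 d).prod (𝓡 d)) 1
      (fun y => (⟨e.symm y, mfderiv (𝓡 d) (𝓡 d) e.symm y v⟩ : TangentBundle (𝓡 d) M))
      e.target := by
    intro v
    have h1 : ContMDiffOn (𝓡 d).tangent (𝓡 d).tangent 1
        (tangentMapWithin (𝓡 d) (𝓡 d) e.symm e.target) (π (EuclideanSpace ℝ (Fin d))
          (TangentSpace (𝓡 d) : EuclideanSpace ℝ (Fin d) → Type _) ⁻¹' e.target) :=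
      (contMDiffOn_chart_symm (I := 𝓡 d) (n := 2) (x := p)).contMDiffOn_tangentMapWithin
        (by norm_num) e.open_target.uniqueMDiffOn
    have h2 : ContMDiff (𝓡 d) (𝓡 d).tangent 1 (fun y : EuclideanSpace ℝ (Fin d) =>
        (⟨y, v⟩ : TangentBundle (𝓡 d) (EuclideanSpace ℝ (Fin d)))) := by
      have h : ContDiff ℝ 1 (fun _ : EuclideanSpace ℝ (Fin d) => v) := contDiff_const
      exact contMDiff_vectorSpace_iff_contDiff.2 h
    refine (h1.comp h2.contMDiffOn fun y hy => hy).congr fun y hy => ?_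
    simp only [Function.comp_apply, tangentMapWithin]
    rw [mfderivWithin_of_isOpen e.open_target hy]
  have hinner : ∀ v w : EuclideanSpace ℝ (Fin d), ContDiffOn ℝ 1 (fun y =>
      inner ℝ (mfderiv (𝓡 d) (𝓡 d) e.symm y v : TangentSpace (𝓡 d) (e.symm y))
        (mfderiv (𝓡 d) (𝓡 d) e.symm y w : TangentSpace (𝓡 d) (e.symm y))) e.target := by
    intro v w
    rw [← contMDiffOn_iff_contDiffOn]
    have : IsContMDiffRiemannianBundle (𝓡 d) 1 (EuclideanSpace ℝ (Fin d))
        (fun x : M => TangentSpace (𝓡 d) x) :=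
      IsContMDiffRiemannianBundle.of_le (n := ∞) (by simp)
    exact ContMDiffOn.inner_bundle (IB := 𝓡 d) (F := EuclideanSpace ℝ (Fin d))
      (E := fun x : M => TangentSpace (𝓡 d) x) (hsec v) (hsec w)
  have : gramDet d p = fun y => ∑ s : Equiv.Perm (Fin d), (Equiv.Perm.sign s : ℝ) * ∏ i,
      inner ℝ (mfderiv (𝓡 d) (𝓡 d) e.symm y (EuclideanSpace.single (s i) (1 : ℝ)) :
        TangentSpace (𝓡 d) (e.symm y)) (mfderiv (𝓡 d) (𝓡 d) e.symm y
          (EuclideanSpace.single i (1 : ℝ)) : TangentSpace (𝓡 d) (e.symm y)) := by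
    ext y
    rw [gramDet, Matrix.det_apply']
    rfl
  rw [this]
  exact ContDiffOn.sum fun s _ => contDiffOn_const.mul (contDiffOn_prod fun i _ => hinner _ _)

theorem mfderiv_chartAt_comp_mfderiv_symm (p : M) {y : EuclideanSpace ℝ (Fin d)}
    (hy : y ∈ (chartAt (EuclideanSpace ℝ (Fin d)) p).target) (v : EuclideanSpace ℝ (Fin d)) :
    mfderiv (𝓡 d) (𝓡 d) (chartAt (EuclideanSpace ℝ (Fin d)) p)
      ((chartAt (EuclideanSpace ℝ (Fin d)) p).symm y)
      (mfderiv (𝓡 d) (𝓡 d) (chartAt (EuclideanSpace ℝ (Fin d)) p).symm y v) = v :=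
  DFunLike.congr_fun
    ((mdifferentiable_of_mem_atlas (I := 𝓡 d) (chart_mem_atlas _ p)).comp_symm_deriv hy) v

theorem linearIndependent_map_single {V : Type*} [AddCommGroup V] [Module ℝ V]
    (L : EuclideanSpace ℝ (Fin d) →ₗ[ℝ] V) (hL : LinearMap.ker L = ⊥) :
    LinearIndependent ℝ fun i => L (EuclideanSpace.single i (1 : ℝ)) := by
  have h := (EuclideanSpace.basisFun (Fin d) ℝ).toBasis.linearIndependent.map' L hL
  simpa [Function.comp_def] using h

theorem gramDet_pos (p : M) {y : EuclideanSpace ℝ (Fin d)}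
    (hy : y ∈ (chartAt (EuclideanSpace ℝ (Fin d)) p).target) : 0 < gramDet d p y := by
  refine (Matrix.posDef_gram_of_linearIndependent ?_).det_pos
  set L := mfderiv (𝓡 d) (𝓡 d) (chartAt (EuclideanSpace ℝ (Fin d)) p).symm y
  have hker : LinearMap.ker L.toLinearMap = ⊥ := by
    refine LinearMap.ker_eq_bot_of_inverse (g := (mfderiv (𝓡 d) (𝓡 d)
      (chartAt (EuclideanSpace ℝ (Fin d)) p)
      ((chartAt (EuclideanSpace ℝ (Fin d)) p).symm y)).toLinearMap) ?_
    ext v : 1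
    exact mfderiv_chartAt_comp_mfderiv_symm d p hy v
  exact linearIndependent_map_single d L.toLinearMap hker

theorem chartDensity_pos (p : M) {y : EuclideanSpace ℝ (Fin d)}
    (hy : y ∈ (chartAt (EuclideanSpace ℝ (Fin d)) p).target) : 0 < chartDensity d p y :=
  Real.sqrt_pos.2 (gramDet_pos d p hy)

theorem contDiffOn_chartDensity (p : M) :
    ContDiffOn ℝ 1 (chartDensity d p) (chartAt (EuclideanSpace ℝ (Fin d)) p).target :=
  (contDiffOn_gramDet d p).sqrt fun _ hy => (gramDet_pos d p hy).ne'

/-- The Gram matrix of the combinations is XᵀGX. -/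
theorem sqrt_det_gram_sum {V ι : Type*} [Fintype ι] [DecidableEq ι] [NormedAddCommGroup V]
    [InnerProductSpace ℝ V] (X : Matrix ι ι ℝ) (u : ι → V) :
    Real.sqrt (Matrix.gram ℝ (fun i => ∑ j, X j i • u j)).det =
      |X.det| * Real.sqrt (Matrix.gram ℝ u).det := by
  have : Matrix.gram ℝ (fun i => ∑ j, X j i • u j) = X.transpose * Matrix.gram ℝ u * X := by
    ext i j
    simp only [Matrix.gram_apply, sum_inner, inner_sum, Matrix.mul_apply, Matrix.transpose_apply,
      real_inner_smul_left, real_inner_smul_right, Finset.sum_mul]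
    exact Finset.sum_congr rfl fun k _ => Finset.sum_congr rfl fun l _ => by ring
  rw [this, Matrix.det_mul, Matrix.det_mul, Matrix.det_transpose,
    show X.det * (Matrix.gram ℝ u).det * X.det = X.det ^ 2 * (Matrix.gram ℝ u).det by ring,
    Real.sqrt_mul (sq_nonneg _), Real.sqrt_sq_eq_abs]

/-- In an orthonormal basis b, the families v and Lv have the same coefficients over b and Lb, and
`normDet` is the root of the Gram determinant of Lb. -/
theorem normDet_mul_sqrt_det_gram {V W : Type*} [NormedAddCommGroup V] [InnerProductSpace ℝ V]
    [FiniteDimensional ℝ V] [NormedAddCommGroup W] [InnerProductSpace ℝ W]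
    (hV : Module.finrank ℝ V = d) (L : V →ₗ[ℝ] W) (v : Fin d → V) :
    L.normDet * Real.sqrt (Matrix.gram ℝ v).det =
      Real.sqrt (Matrix.gram ℝ (fun i => L (v i))).det := by
  obtain ⟨b⟩ : Nonempty (OrthonormalBasis (Fin d) ℝ V) :=
    ⟨(stdOrthonormalBasis ℝ V).reindex (finCongr hV)⟩
  have hv : v = fun i => ∑ j, (Matrix.of fun j i => b.repr (v i) j) j i • b j := by
    ext i; exact (b.sum_repr (v i)).symm
  have hLv : (fun i => L (v i)) =
      fun i => ∑ j, (Matrix.of fun j i => b.repr (v i) j) j i • L (b j) := by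
    ext i
    conv_lhs => rw [hv]
    simp
  have hb : Matrix.gram ℝ b = 1 := by
    ext i j
    rw [Matrix.gram_apply, orthonormal_iff_ite.1 b.orthonormal, Matrix.one_apply]
  have hL : Real.sqrt (Matrix.gram ℝ (fun i => L (b i))).det = L.normDet := by
    have := L.normDet_sq_eq_det_gram b
    rw [← this]
    exact Real.sqrt_sq L.normDet_nonneg
  rw [hLv, sqrt_det_gram_sum, hL]
  conv_lhs => rw [hv]
  rw [sqrt_det_gram_sum, hb]
  simp [mul_comm]

theorem sqrt_det_gram_comp {V : Type*} [NormedAddCommGroup V] [InnerProductSpace ℝ V]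
    (v : EuclideanSpace ℝ (Fin d) →ₗ[ℝ] V)
    (A : EuclideanSpace ℝ (Fin d) →ₗ[ℝ] EuclideanSpace ℝ (Fin d)) :
    Real.sqrt (Matrix.gram ℝ (fun i => v (A (EuclideanSpace.single i (1 : ℝ))))).det =
      |LinearMap.det A| *
        Real.sqrt (Matrix.gram ℝ (fun i => v (EuclideanSpace.single i (1 : ℝ)))).det := by
  let b := (EuclideanSpace.basisFun (Fin d) ℝ).toBasis
  rw [← LinearMap.det_toMatrix b, ← sqrt_det_gram_sum]
  congr 4
  ext i
  have h := b.sum_repr (A (EuclideanSpace.single i (1 : ℝ)))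
  conv_lhs => rw [← h]
  simp [LinearMap.toMatrix_apply, b]

theorem gram_congr_of_eq {ι : Type*} {w z : M} (h : w = z)
    {u : ι → TangentSpace (𝓡 d) w} {v : ι → TangentSpace (𝓡 d) z}
    (huv : ∀ i, (show EuclideanSpace ℝ (Fin d) from u i) = v i) :
    Matrix.gram ℝ u = Matrix.gram ℝ v := by
  subst h
  have : u = v := funext huv
  rw [this]

/-- The Jacobian of `f` in charts. -/
theorem absDetDeriv_mul_chartDensity {f : M → M} {p q : M} {y : EuclideanSpace ℝ (Fin d)}
    (hy : y ∈ (chartAt (EuclideanSpace ℝ (Fin d)) p).target)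
    (hq : f ((chartAt (EuclideanSpace ℝ (Fin d)) p).symm y) ∈
      (chartAt (EuclideanSpace ℝ (Fin d)) q).source)
    (hf : MDifferentiableAt (𝓡 d) (𝓡 d) f ((chartAt (EuclideanSpace ℝ (Fin d)) p).symm y)) :
    DifferentiableAt ℝ (chartAt (EuclideanSpace ℝ (Fin d)) q ∘ f ∘
        (chartAt (EuclideanSpace ℝ (Fin d)) p).symm) y ∧
    absDetDeriv d f ((chartAt (EuclideanSpace ℝ (Fin d)) p).symm y) * chartDensity d p y =
      |(fderiv ℝ (chartAt (EuclideanSpace ℝ (Fin d)) q ∘ f ∘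
        (chartAt (EuclideanSpace ℝ (Fin d)) p).symm) y).det| *
        chartDensity d q (chartAt (EuclideanSpace ℝ (Fin d)) q
          (f ((chartAt (EuclideanSpace ℝ (Fin d)) p).symm y))) := by
  set e := chartAt (EuclideanSpace ℝ (Fin d)) p with he
  set e' := chartAt (EuclideanSpace ℝ (Fin d)) q with he'
  have hsymm : MDifferentiableAt (𝓡 d) (𝓡 d) e.symm y :=
    mdifferentiableAt_atlas_symm (chart_mem_atlas _ p) hy
  have hsymm' : MDifferentiableAt (𝓡 d) (𝓡 d) e'.symm (e' (f (e.symm y))) :=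
    mdifferentiableAt_atlas_symm (chart_mem_atlas _ q) (e'.map_source hq)
  have hchart' : MDifferentiableAt (𝓡 d) (𝓡 d) e' (f (e.symm y)) :=
    mdifferentiableAt_atlas (chart_mem_atlas _ q) hq
  have hfe : MDifferentiableAt (𝓡 d) (𝓡 d) (f ∘ e.symm) y := hf.comp y hsymm
  have hF : MDifferentiableAt (𝓡 d) (𝓡 d) (e' ∘ f ∘ e.symm) y := hchart'.comp y hfe
  refine ⟨hF.differentiableAt, ?_⟩
  have hchain : ∀ v : EuclideanSpace ℝ (Fin d),
      (show EuclideanSpace ℝ (Fin d) from mfderiv (𝓡 d) (𝓡 d) e'.symm (e' (f (e.symm y)))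
        (fderiv ℝ (e' ∘ f ∘ e.symm) y v)) =
      mfderiv (𝓡 d) (𝓡 d) f (e.symm y) (mfderiv (𝓡 d) (𝓡 d) e.symm y v) := by
    intro v
    have h1 := mfderiv_comp y (I := 𝓡 d) (I' := 𝓡 d) (I'' := 𝓡 d) hsymm' hF
    have h2 := mfderiv_comp y (I := 𝓡 d) (I' := 𝓡 d) (I'' := 𝓡 d) hf hsymm
    have hcont : ContinuousAt (f ∘ e.symm) y := hfe.continuousAt
    have h3 : e'.symm ∘ (e' ∘ f ∘ e.symm) =ᶠ[𝓝 y] f ∘ e.symm := by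
      filter_upwards [hcont.preimage_mem_nhds (e'.open_source.mem_nhds hq)] with z hz
      exact e'.left_inv hz
    have h4 := h3.mfderiv_eq (I := 𝓡 d) (I' := 𝓡 d)
    rw [h1, h2, mfderiv_eq_fderiv] at h4
    exact DFunLike.congr_fun h4 v
  have hFD : FiniteDimensional ℝ (TangentSpace (𝓡 d) (e.symm y)) :=
    inferInstanceAs (FiniteDimensional ℝ (EuclideanSpace ℝ (Fin d)))
  have h5 := normDet_mul_sqrt_det_gram d (V := TangentSpace (𝓡 d) (e.symm y))
    (W := TangentSpace (𝓡 d) (f (e.symm y))) (finrank_euclideanSpace_fin (𝕜 := ℝ) (n := d))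
    (mfderiv (𝓡 d) (𝓡 d) f (e.symm y)).toLinearMap
    (fun i => mfderiv (𝓡 d) (𝓡 d) e.symm y (EuclideanSpace.single i (1 : ℝ)))
  have h6 := sqrt_det_gram_comp d
    (V := TangentSpace (𝓡 d) (e'.symm (e' (f (e.symm y)))))
    (mfderiv (𝓡 d) (𝓡 d) e'.symm (e' (f (e.symm y)))).toLinearMap
    (fderiv ℝ (e' ∘ f ∘ e.symm) y).toLinearMap
  have h7 := gram_congr_of_eq d (e'.left_inv hq)
    (u := fun i : Fin d => mfderiv (𝓡 d) (𝓡 d) e'.symm (e' (f (e.symm y)))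
      (fderiv ℝ (e' ∘ f ∘ e.symm) y (EuclideanSpace.single i (1 : ℝ))))
    (v := fun i : Fin d => mfderiv (𝓡 d) (𝓡 d) f (e.symm y) (mfderiv (𝓡 d) (𝓡 d) e.symm y
      (EuclideanSpace.single i (1 : ℝ)))) fun i => hchain _
  refine Eq.trans h5 (Eq.trans ?_ h6)
  exact congrArg (fun A : Matrix (Fin d) (Fin d) ℝ => Real.sqrt A.det) h7.symm

end Density

/-! ### The Riemannian volume in charts. -/

section Volume

open Metric Set HyperbolicTimes

set_option linter.unusedSectionVars false

variable (d : ℕ) {M : Type*} [MetricSpace M] [CompactSpace M]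
  [ChartedSpace (EuclideanSpace ℝ (Fin d)) M]
  [IsManifold (𝓡 d) ∞ M] [RiemannianBundle (fun x : M => TangentSpace (𝓡 d) x)]
  [IsContMDiffRiemannianBundle (𝓡 d) ∞ (EuclideanSpace ℝ (Fin d))
    (fun x : M => TangentSpace (𝓡 d) x)]
  [IsRiemannianManifold (𝓡 d) M] [MeasurableSpace M] [BorelSpace M]

theorem chartVolume_apply (p : M) {A : Set M} (hA : MeasurableSet A) :
    chartVolume d M p A = ∫⁻ y in (chartAt (EuclideanSpace ℝ (Fin d)) p) ''
      (A ∩ (chartAt (EuclideanSpace ℝ (Fin d)) p).source), ENNReal.ofReal (chartDensity d p y) := by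
  set e := chartAt (EuclideanSpace ℝ (Fin d)) p
  rw [chartVolume_eq, Measure.map_apply_of_aemeasurable _ hA, withDensity_apply',
    Measure.restrict_restrict' e.open_target.measurableSet]
  · congr 2
    rw [inter_comm A, e.image_source_inter_eq', inter_comm]
  · exact (e.continuousOn_symm.aemeasurable e.open_target.measurableSet).mono_ac
      (withDensity_absolutelyContinuous _ _)

theorem chartVolume_compl_source (p : M) :
    chartVolume d M p (chartAt (EuclideanSpace ℝ (Fin d)) p).sourceᶜ = 0 := by
  rw [chartVolume_apply d p (chartAt _ p).open_source.measurableSet.compl]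
  simp

/-- Euclidean change of variables for `f` read in charts; the Jacobian formula turns the density at
the image into the one at the source. The case `f = id` shows that chart volumes agree on overlaps.
-/
theorem chartVolume_image {f : M → M} {p q : M} {A : Set M} (hA : MeasurableSet A)
    (hp : A ⊆ (chartAt (EuclideanSpace ℝ (Fin d)) p).source)
    (hq : f '' A ⊆ (chartAt (EuclideanSpace ℝ (Fin d)) q).source) (hinj : InjOn f A)
    (hf : ∀ x ∈ A, MDifferentiableAt (𝓡 d) (𝓡 d) f x) :
    MeasurableSet (f '' A) ∧ chartVolume d M q (f '' A) =
      ∫⁻ y in (chartAt (EuclideanSpace ℝ (Fin d)) p) '' A,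
        ENNReal.ofReal (absDetDeriv d f ((chartAt (EuclideanSpace ℝ (Fin d)) p).symm y)
          * chartDensity d p y) := by
  set e := chartAt (EuclideanSpace ℝ (Fin d)) p
  set e' := chartAt (EuclideanSpace ℝ (Fin d)) q
  have hfA : MeasurableSet (f '' A) := hA.image_of_continuousOn_injOn
    (fun x hx => (hf x hx).continuousAt.continuousWithinAt) hinj
  refine ⟨hfA, ?_⟩
  have heA : MeasurableSet (e '' A) := hA.image_of_continuousOn_injOn
    (e.continuousOn.mono hp) (e.injOn.mono hp)
  rw [chartVolume_apply d q hfA, inter_eq_left.2 hq]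
  have himg : e' '' (f '' A) = (e' ∘ f ∘ e.symm) '' (e '' A) := by
    rw [image_comp, image_comp]
    congr 2
    rw [← image_comp]
    exact ((image_congr fun x hx => e.left_inv (hp hx)).trans (image_id A)).symm
  have hsymm : ∀ y ∈ e '' A, y ∈ e.target ∧ e.symm y ∈ A := by
    rintro _ ⟨x, hx, rfl⟩
    exact ⟨e.map_source (hp hx), (e.left_inv (hp hx)).symm ▸ hx⟩
  have hJ := fun y hy => absDetDeriv_mul_chartDensity d (p := p) (q := q) (f := f) (y := y)
    (hsymm y hy).1 (hq (mem_image_of_mem f (hsymm y hy).2)) (hf _ (hsymm y hy).2)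
  have hinjF : InjOn (e' ∘ f ∘ e.symm) (e '' A) := by
    rintro _ ⟨x, hx, rfl⟩ _ ⟨z, hz, rfl⟩ h
    simp only [Function.comp_apply, e.left_inv (hp hx), e.left_inv (hp hz)] at h
    rw [hinj hx hz (e'.injOn (hq (mem_image_of_mem f hx)) (hq (mem_image_of_mem f hz)) h)]
  rw [himg, lintegral_image_eq_lintegral_abs_det_fderiv_mul volume heA
    (fun y hy => (hJ y hy).1.hasFDerivAt.hasFDerivWithinAt) hinjF]
  refine setLIntegral_congr_fun heA fun y hy => ?_
  rw [(hJ y hy).2, ENNReal.ofReal_mul (abs_nonneg _)]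
  rfl

theorem absDetDeriv_id (x : M) : absDetDeriv d (id : M → M) x = 1 := by
  have hFD : FiniteDimensional ℝ (TangentSpace (𝓡 d) x) :=
    inferInstanceAs (FiniteDimensional ℝ (EuclideanSpace ℝ (Fin d)))
  rw [absDetDeriv, mfderiv_id]
  exact LinearMap.normDet_id

theorem chartVolume_eq_chartVolume {p q : M} {A : Set M} (hA : MeasurableSet A)
    (hp : A ⊆ (chartAt (EuclideanSpace ℝ (Fin d)) p).source)
    (hq : A ⊆ (chartAt (EuclideanSpace ℝ (Fin d)) q).source) :
    chartVolume d M q A = chartVolume d M p A := by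
  have h := (chartVolume_image d (f := id) hA hp (by simpa using hq) (injOn_id A)
    fun x _ => mdifferentiableAt_id).2
  rw [image_id] at h
  rw [h, chartVolume_apply d p hA, inter_eq_left.2 hp]
  simp only [absDetDeriv_id, one_mul]

theorem riemannianVolume_apply {p : M} {A : Set M} (hA : MeasurableSet A)
    (hp : A ⊆ (chartAt (EuclideanSpace ℝ (Fin d)) p).source) :
    riemannianVolume d M A = chartVolume d M p A := by
  set s := (chartAt (EuclideanSpace ℝ (Fin d)) p).source with hs
  have hsm : MeasurableSet s := (chartAt _ p).open_source.measurableSet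
  apply le_antisymm
  -- Each chart volume obeys this bound, hence so does their supremum. The second term vanishes on
  -- subsets of `s`.
  · have hle : riemannianVolume d M ≤
        chartVolume d M p + (riemannianVolume d M).restrict sᶜ := by
      refine iSup_le fun q => Measure.le_iff.2 fun B hB => ?_
      set s' := (chartAt (EuclideanSpace ℝ (Fin d)) q).source
      have hs'm : MeasurableSet s' := (chartAt _ q).open_source.measurableSet
      have h1 : chartVolume d M q (B ∩ s) ≤ chartVolume d M p B := by
        calc chartVolume d M q (B ∩ s)
            ≤ chartVolume d M q (B ∩ s ∩ s') + chartVolume d M q s'ᶜ := by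
              refine (measure_mono ?_).trans (measure_union_le _ _)
              intro x hx
              by_cases h : x ∈ s'
              · exact Or.inl ⟨hx, h⟩
              · exact Or.inr h
          _ = chartVolume d M p (B ∩ s ∩ s') := by
              rw [chartVolume_compl_source, add_zero]
              exact chartVolume_eq_chartVolume d ((hB.inter hsm).inter hs'm)
                (inter_subset_left.trans inter_subset_right) inter_subset_right
          _ ≤ _ := measure_mono (inter_subset_left.trans inter_subset_left)
      have h2 : chartVolume d M q (B \ s) ≤ (riemannianVolume d M).restrict sᶜ B := by
        rw [Measure.restrict_apply hB]
        exact le_iSup (fun q => chartVolume d M q) q (B ∩ sᶜ)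
      rw [← measure_inter_add_sdiff B hsm]
      exact add_le_add h1 h2
    refine (hle A).trans ?_
    rw [Measure.add_apply, Measure.restrict_apply hA, (disjoint_compl_right_iff_subset.2 hp).inter_eq]
    simp
  · exact le_iSup (fun q => chartVolume d M q) p A

theorem riemannianVolume_image_bounds {f : M → M} {p q : M} {A : Set M} (hA : MeasurableSet A)
    (hp : A ⊆ (chartAt (EuclideanSpace ℝ (Fin d)) p).source)
    (hq : f '' A ⊆ (chartAt (EuclideanSpace ℝ (Fin d)) q).source) (hinj : InjOn f A)
    (hf : ∀ x ∈ A, MDifferentiableAt (𝓡 d) (𝓡 d) f x) {α : ℝ} (hα : 0 ≤ α) :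
    ((∀ x ∈ A, absDetDeriv d f x ≤ α) →
      riemannianVolume d M (f '' A) ≤ ENNReal.ofReal α * riemannianVolume d M A) ∧
    ((∀ x ∈ A, α ≤ absDetDeriv d f x) →
      ENNReal.ofReal α * riemannianVolume d M A ≤ riemannianVolume d M (f '' A)) := by
  set e := chartAt (EuclideanSpace ℝ (Fin d)) p
  obtain ⟨hfA, h⟩ := chartVolume_image d hA hp hq hinj hf
  have heA : MeasurableSet (e '' A) := hA.image_of_continuousOn_injOn
    (e.continuousOn.mono hp) (e.injOn.mono hp)
  rw [riemannianVolume_apply d hfA hq, riemannianVolume_apply d hA hp, h, chartVolume_apply d p hA,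
    inter_eq_left.2 hp, ← lintegral_const_mul' _ _ ENNReal.ofReal_ne_top]
  constructor
  · intro hJ
    refine setLIntegral_mono' heA ?_
    rintro _ ⟨x, hx, rfl⟩
    rw [← ENNReal.ofReal_mul hα, e.left_inv (hp hx)]
    exact ENNReal.ofReal_le_ofReal (mul_le_mul_of_nonneg_right (hJ x hx) (Real.sqrt_nonneg _))
  · intro hJ
    refine setLIntegral_mono' heA ?_
    rintro _ ⟨x, hx, rfl⟩
    rw [← ENNReal.ofReal_mul hα, e.left_inv (hp hx)]
    exact ENNReal.ofReal_le_ofReal (mul_le_mul_of_nonneg_right (hJ x hx) (Real.sqrt_nonneg _))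

end Volume

/-! ### Global volume distortion, finiteness, and nullity of submanifolds. -/

section VolumeProperties

open Metric Set HyperbolicTimes

set_option linter.unusedSectionVars false

variable (d : ℕ) {M : Type*} [MetricSpace M] [CompactSpace M]
  [ChartedSpace (EuclideanSpace ℝ (Fin d)) M]
  [IsManifold (𝓡 d) ∞ M] [RiemannianBundle (fun x : M => TangentSpace (𝓡 d) x)]
  [IsContMDiffRiemannianBundle (𝓡 d) ∞ (EuclideanSpace ℝ (Fin d))
    (fun x : M => TangentSpace (𝓡 d) x)]
  [IsRiemannianManifold (𝓡 d) M] [MeasurableSpace M] [BorelSpace M]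

theorem exists_measurable_partition_chartAt_source [Nonempty M] : ∃ (p : ℕ → M) (D : ℕ → Set M),
    (∀ n, MeasurableSet (D n)) ∧ Pairwise (Function.onFun Disjoint D) ∧ ⋃ n, D n = univ ∧
      ∀ n, D n ⊆ (chartAt (EuclideanSpace ℝ (Fin d)) (p n)).source := by
  obtain ⟨s, hs, hcov⟩ := TopologicalSpace.countable_cover_nhds
    fun x : M => chart_source_mem_nhds (EuclideanSpace ℝ (Fin d)) x
  have hne : s.Nonempty := by
    by_contra h
    rw [not_nonempty_iff_eq_empty.1 h] at hcov
    simp only [mem_empty_iff_false, iUnion_of_empty, iUnion_empty] at hcov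
    exact empty_ne_univ hcov
  obtain ⟨p, rfl⟩ := hs.exists_eq_range hne
  refine ⟨p, disjointed fun n => (chartAt (EuclideanSpace ℝ (Fin d)) (p n)).source,
    MeasurableSet.disjointed fun n => (chartAt _ (p n)).open_source.measurableSet,
    disjoint_disjointed _, ?_, disjointed_subset _⟩
  rw [iUnion_disjointed]
  simpa using hcov

/-- `A` is cut into countably many pieces, each with itself and its image in one chart domain;
injectivity keeps the images disjoint, so the bounds add up. -/
theorem controlsVolume_riemannianVolume [Nonempty M] {f : M → M} (hfc : Continuous f) {S : Set M}
    (hf : ∀ x ∉ S, MDifferentiableAt (𝓡 d) (𝓡 d) f x) :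
    ControlsVolume f S (absDetDeriv d f) (riemannianVolume d M) := by
  intro A hA hAS hinj α hα
  obtain ⟨p, D, hD, hDd, hDc, hDs⟩ := exists_measurable_partition_chartAt_source d (M := M)
  let P : ℕ × ℕ → Set M := fun ij => A ∩ (D ij.1 ∩ f ⁻¹' D ij.2)
  have hPm : ∀ ij, MeasurableSet (P ij) := fun ij =>
    hA.inter ((hD _).inter (hfc.measurable (hD _)))
  have hPA : ∀ ij, P ij ⊆ A := fun ij => inter_subset_left
  have hPd : Pairwise (Function.onFun Disjoint P) := by
    rintro ⟨i, j⟩ ⟨i', j'⟩ hne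
    refine disjoint_left.2 fun x hx hx' => hne ?_
    have h1 : i = i' := by
      by_contra h; exact disjoint_left.1 (hDd h) hx.2.1 hx'.2.1
    have h2 : j = j' := by
      by_contra h; exact disjoint_left.1 (hDd h) hx.2.2 hx'.2.2
    rw [h1, h2]
  have hPU : ⋃ ij, P ij = A := by
    refine subset_antisymm (iUnion_subset hPA) fun x hx => ?_
    obtain ⟨i, hi⟩ := mem_iUnion.1 (hDc.symm ▸ mem_univ x)
    obtain ⟨j, hj⟩ := mem_iUnion.1 (hDc.symm ▸ mem_univ (f x))
    exact mem_iUnion.2 ⟨(i, j), hx, hi, hj⟩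
  have himg : f '' A = ⋃ ij, f '' P ij := by rw [← image_iUnion, hPU]
  have hfPm : ∀ ij, MeasurableSet (f '' P ij) := fun ij =>
    (hPm ij).image_of_continuousOn_injOn hfc.continuousOn (hinj.mono (hPA ij))
  have hfPd : Pairwise (Function.onFun Disjoint fun ij => f '' P ij) := by
    intro i j hij
    refine disjoint_left.2 ?_
    rintro _ ⟨x, hx, rfl⟩ ⟨y, hy, hxy⟩
    rw [hinj (hPA j hy) (hPA i hx) hxy] at hy
    exact disjoint_left.1 (hPd hij) hx hy
  have hb := fun ij => riemannianVolume_image_bounds d (p := p ij.1) (q := p ij.2) (hPm ij)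
    (fun x hx => hDs _ hx.2.1) (by rintro _ ⟨x, hx, rfl⟩; exact hDs _ hx.2.2)
    (hinj.mono (hPA ij)) (fun x hx => hf x (hAS (hPA ij hx))) hα
  have hmA : riemannianVolume d M A = ∑' ij, riemannianVolume d M (P ij) := by
    conv_lhs => rw [← hPU]
    exact measure_iUnion hPd hPm
  rw [himg, measure_iUnion hfPd hfPm, hmA, ← ENNReal.tsum_mul_left]
  exact ⟨fun h => ENNReal.tsum_le_tsum fun ij => (hb ij).1 fun x hx => h x (hPA ij hx),
    fun h => ENNReal.tsum_le_tsum fun ij => (hb ij).2 fun x hx => h x (hPA ij hx)⟩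

/-- A small neighborhood of a point, on which the Riemannian volume is comparable to the Lebesgue
measure in the chart. -/
theorem exists_nhds_riemannianVolume (p : M) {W : Set M} (hW : W ∈ 𝓝 p) :
    ∃ V ∈ 𝓝 p, V ⊆ W ∧ 0 < riemannianVolume d M V ∧ riemannianVolume d M V < ⊤ := by
  set e := chartAt (EuclideanSpace ℝ (Fin d)) p
  have hp : p ∈ e.source := mem_chart_source _ p
  have hep : e p ∈ e.target := e.map_source hp
  have hcont : ContinuousAt (chartDensity d p) (e p) :=
    (contDiffOn_chartDensity d p).continuousOn.continuousAt (e.open_target.mem_nhds hep)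
  set c := chartDensity d p (e p) with hc
  have hc0 : 0 < c := chartDensity_pos d p hep
  have hWe : e.symm ⁻¹' W ∈ 𝓝 (e p) :=
    (e.continuousAt_symm hep).preimage_mem_nhds (by rwa [e.left_inv hp])
  have hev : ∀ᶠ y in 𝓝 (e p), c / 2 < chartDensity d p y ∧ chartDensity d p y < 2 * c ∧
      y ∈ e.target ∧ e.symm y ∈ W :=
    (hcont.eventually_const_lt (half_lt_self hc0)).and
      ((hcont.eventually_lt_const (show c < 2 * c by linarith)).and
        ((show ∀ᶠ y in 𝓝 (e p), y ∈ e.target from e.open_target.mem_nhds hep).and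
          (show ∀ᶠ y in 𝓝 (e p), e.symm y ∈ W from hWe)))
  obtain ⟨r, hr, hball⟩ := Metric.mem_nhds_iff.1 hev
  have hbt : ball (e p) r ⊆ e.target := fun y hy => (hball hy).2.2.1
  have hVo : IsOpen (e.symm '' ball (e p) r) :=
    e.symm.isOpen_image_of_subset_source isOpen_ball hbt
  have hVs : e.symm '' ball (e p) r ⊆ e.source := by
    rintro _ ⟨y, hy, rfl⟩
    exact e.map_target (hbt hy)
  have hVe : e '' (e.symm '' ball (e p) r) = ball (e p) r := by
    rw [← image_comp]
    exact (image_congr fun y hy => e.right_inv (hbt hy)).trans (image_id _)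
  refine ⟨_, hVo.mem_nhds ⟨e p, mem_ball_self hr, e.left_inv hp⟩, ?_, ?_⟩
  · rintro _ ⟨y, hy, rfl⟩
    exact (hball hy).2.2.2
  rw [riemannianVolume_apply d hVo.measurableSet hVs, chartVolume_apply d p hVo.measurableSet,
    inter_eq_left.2 hVs, hVe]
  constructor
  · calc 0 < ENNReal.ofReal (c / 2) * volume (ball (e p) r) :=
          ENNReal.mul_pos (by simpa using hc0) (measure_ball_pos _ _ hr).ne'
      _ = ∫⁻ y in ball (e p) r, ENNReal.ofReal (c / 2) := (setLIntegral_const _ _).symm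
      _ ≤ _ := setLIntegral_mono' measurableSet_ball fun y hy =>
          ENNReal.ofReal_le_ofReal (hball hy).1.le
  · calc _ ≤ ∫⁻ y in ball (e p) r, ENNReal.ofReal (2 * c) :=
          setLIntegral_mono' measurableSet_ball fun y hy =>
            ENNReal.ofReal_le_ofReal (hball hy).2.1.le
      _ = ENNReal.ofReal (2 * c) * volume (ball (e p) r) := setLIntegral_const _ _
      _ < ⊤ := ENNReal.mul_lt_top ENNReal.ofReal_lt_top measure_ball_lt_top

theorem isFiniteMeasure_riemannianVolume : IsFiniteMeasure (riemannianVolume d M) := by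
  have : IsLocallyFiniteMeasure (riemannianVolume d M) := ⟨fun p => by
    obtain ⟨V, hV, -, -, h⟩ := exists_nhds_riemannianVolume d p univ_mem
    exact ⟨V, hV, h⟩⟩
  infer_instance

theorem riemannianVolume_pos {U : Set M} (hU : IsOpen U) (hne : U.Nonempty) :
    0 < riemannianVolume d M U := by
  obtain ⟨p, hp⟩ := hne
  obtain ⟨V, -, hVU, h, -⟩ := exists_nhds_riemannianVolume d p (hU.mem_nhds hp)
  exact h.trans_le (measure_mono hVU)

/-- In a slice chart, `S` lies in the hyperplane where coordinate `k` vanishes. The differentiable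
transition to the preferred chart preserves null sets. -/
theorem riemannianVolume_eq_zero_of_isSubmanifoldOfLowerDim {S : Set M} (hSc : IsClosed S)
    (hS : IsSubmanifoldOfLowerDim d S) : riemannianVolume d M S = 0 := by
  refine measure_null_of_locally_null S fun p hp => ?_
  obtain ⟨k, hk, e, he, hpe, hSe⟩ := hS p hp
  set e' := chartAt (EuclideanSpace ℝ (Fin d)) p
  have hO : IsOpen (e.source ∩ e'.source) := e.open_source.inter e'.open_source
  refine ⟨S ∩ (e.source ∩ e'.source), inter_mem self_mem_nhdsWithin
    (mem_nhdsWithin_of_mem_nhds (hO.mem_nhds ⟨hpe, mem_chart_source _ p⟩)), ?_⟩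
  set A := S ∩ (e.source ∩ e'.source)
  have hA : MeasurableSet A := hSc.measurableSet.inter hO.measurableSet
  have hAe' : A ⊆ e'.source := fun x hx => hx.2.2
  have hAe : A ⊆ e.source := fun x hx => hx.2.1
  rw [riemannianVolume_apply d hA hAe', chartVolume_apply d p hA, inter_eq_left.2 hAe']
  refine setLIntegral_measure_zero _ _ ?_
  have himg : e' '' A = (e' ∘ e.symm) '' (e '' A) := by
    rw [image_comp]
    congr 1
    rw [← image_comp]
    exact ((image_congr fun x hx => e.left_inv (hAe hx)).trans (image_id A)).symm
  rw [himg]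
  let i : Fin d := ⟨k, hk⟩
  refine addHaar_image_eq_zero_of_differentiableOn_of_addHaar_eq_zero volume ?_ ?_
  · rintro _ ⟨x, hx, rfl⟩
    have h1 : ContMDiffAt (𝓡 d) (𝓡 d) 1 e.symm (e x) :=
      (contMDiffOn_symm_of_mem_maximalAtlas he).contMDiffAt
        (e.open_target.mem_nhds (e.map_source (hAe hx)))
    have h2 : ContMDiffAt (𝓡 d) (𝓡 d) 1 e' (e.symm (e x)) := by
      rw [e.left_inv (hAe hx)]
      exact (contMDiffOn_chart (I := 𝓡 d) (n := 1) (x := p)).contMDiffAt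
        (e'.open_source.mem_nhds (hAe' hx))
    have h3 := (h2.comp (e x) h1).mdifferentiableAt one_ne_zero
    exact h3.differentiableAt.differentiableWithinAt
  · let K : Submodule ℝ (EuclideanSpace ℝ (Fin d)) :=
      LinearMap.ker (EuclideanSpace.proj i : EuclideanSpace ℝ (Fin d) →L[ℝ] ℝ).toLinearMap
    have hK : K ≠ ⊤ := by
      intro h
      have : EuclideanSpace.single i (1 : ℝ) ∈ K := h ▸ Submodule.mem_top
      simp [K] at this
    refine measure_mono_null ?_ (Measure.addHaar_submodule volume K hK)
    rintro _ ⟨x, hx, rfl⟩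
    have := (hSe x (hAe hx)).1 hx.1 i le_rfl
    simpa [K] using this

end VolumeProperties

/-! ### Local Lipschitz continuity of the log-Jacobian. -/

section LogJacobian

open Metric Set HyperbolicTimes

set_option linter.unusedSectionVars false

theorem contDiff_continuousLinearMap_det (d : ℕ) :
    ContDiff ℝ 1 fun A : EuclideanSpace ℝ (Fin d) →L[ℝ] EuclideanSpace ℝ (Fin d) => A.det := by
  have : (fun A : EuclideanSpace ℝ (Fin d) →L[ℝ] EuclideanSpace ℝ (Fin d) => A.det) =
      fun A => ∑ s : Equiv.Perm (Fin d), (Equiv.Perm.sign s : ℝ) *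
        ∏ i, A (EuclideanSpace.single i (1 : ℝ)) (s i) := by
    ext A
    rw [ContinuousLinearMap.det, ← LinearMap.det_toMatrix
      (EuclideanSpace.basisFun (Fin d) ℝ).toBasis, Matrix.det_apply']
    simp [LinearMap.toMatrix_apply]
  rw [this]
  refine ContDiff.sum fun s _ => contDiff_const.mul (contDiff_prod fun i _ => ?_)
  exact ((EuclideanSpace.proj (𝕜 := ℝ) (s i)).comp
    (ContinuousLinearMap.apply ℝ _ (EuclideanSpace.single i (1 : ℝ)))).contDiff

variable (d : ℕ) {M : Type*} [MetricSpace M]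
  [ChartedSpace (EuclideanSpace ℝ (Fin d)) M]
  [IsManifold (𝓡 d) ∞ M] [RiemannianBundle (fun x : M => TangentSpace (𝓡 d) x)]
  [IsContMDiffRiemannianBundle (𝓡 d) ∞ (EuclideanSpace ℝ (Fin d))
    (fun x : M => TangentSpace (𝓡 d) x)]
  [IsRiemannianManifold (𝓡 d) M]

theorem absDetDeriv_pos {f : M → M} {x : M} (hf : IsLocalDiffeomorphAt (𝓡 d) (𝓡 d) 2 f x) :
    0 < absDetDeriv d f x := by
  have hFD : FiniteDimensional ℝ (TangentSpace (𝓡 d) x) :=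
    inferInstanceAs (FiniteDimensional ℝ (EuclideanSpace ℝ (Fin d)))
  obtain ⟨e, he⟩ : (mfderiv (𝓡 d) (𝓡 d) f x).IsInvertible :=
    ⟨hf.mfderivToContinuousLinearEquiv two_ne_zero, hf.mfderivToContinuousLinearEquiv_coe _⟩
  refine lt_of_le_of_ne (LinearMap.normDet_nonneg _) (Ne.symm ?_)
  refine ((LinearMap.normDet_ne_zero_tfae _).out 0 4).2 ?_
  rw [← he]
  exact e.injective

theorem IsLocalDiffeomorphAt.eventually {f : M → M} {x : M}
    (hf : IsLocalDiffeomorphAt (𝓡 d) (𝓡 d) 2 f x) :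
    ∀ᶠ y in 𝓝 x, IsLocalDiffeomorphAt (𝓡 d) (𝓡 d) 2 f y :=
  eventually_of_mem (hf.localInverse.open_target.mem_nhds hf.localInverse_mem_target)
    fun _ => hf.of_mem_localInverse_target

/-- The logarithm of the Jacobian of a `C^2` local diffeomorphism is locally Lipschitz. -/
theorem exists_nhds_abs_log_absDetDeriv_sub_le {f : M → M} {x : M}
    (hf : IsLocalDiffeomorphAt (𝓡 d) (𝓡 d) 2 f x) :
    ∃ c : ℝ, 0 ≤ c ∧ ∃ U ∈ 𝓝 x, ∀ u ∈ U, ∀ v ∈ U,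
      |Real.log (absDetDeriv d f u) - Real.log (absDetDeriv d f v)| ≤ c * dist u v := by
  set e := chartAt (EuclideanSpace ℝ (Fin d)) x with he
  set e' := chartAt (EuclideanSpace ℝ (Fin d)) (f x) with he'
  set F := e' ∘ f ∘ e.symm with hF
  have hx : x ∈ e.source := mem_chart_source _ x
  have hfx : f x ∈ e'.source := mem_chart_source _ (f x)
  have hF2 : ContDiffAt ℝ 2 F (e x) := by
    have h := (contMDiffAt_iff.1 hf.contMDiffAt).2
    simpa [F, e, e', Function.comp_def, contDiffWithinAt_univ] using h
  have hFx : F (e x) = e' (f x) := by simp [F, e.left_inv hx]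
  have hdet : ContDiffAt ℝ 1 (fun y => (fderiv ℝ F y).det) (e x) :=
    (contDiff_continuousLinearMap_det d).contDiffAt.comp (e x)
      (hF2.fderiv_right (m := 1) (by norm_num))
  have hρ : ContDiffAt ℝ 1 (chartDensity d x) (e x) :=
    (contDiffOn_chartDensity d x).contDiffAt (e.open_target.mem_nhds (e.map_source hx))
  have hρ' : ContDiffAt ℝ 1 (fun y => chartDensity d (f x) (F y)) (e x) := by
    refine ContDiffAt.comp (g := chartDensity d (f x)) (e x) ?_ (hF2.of_le one_le_two)
    rw [hFx]
    exact (contDiffOn_chartDensity d (f x)).contDiffAt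
      (e'.open_target.mem_nhds (e'.map_source hfx))
  -- `Real.log` ignores signs, so the determinant needs no absolute value. Each term is `C^1` in the
  -- chart, since `f` is `C^2`.
  have key : ∀ u ∈ e.source, f u ∈ e'.source → IsLocalDiffeomorphAt (𝓡 d) (𝓡 d) 2 f u →
      (fderiv ℝ F (e u)).det ≠ 0 ∧ Real.log (absDetDeriv d f u) =
        Real.log (fderiv ℝ F (e u)).det + Real.log (chartDensity d (f x) (F (e u))) -
          Real.log (chartDensity d x (e u)) := by
    intro u hu hfu hlu
    have h := (absDetDeriv_mul_chartDensity d (p := x) (q := f x) (e.map_source hu)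
      (f := f) (by rwa [e.left_inv hu]) (by
        rw [e.left_inv hu]
        exact hlu.mdifferentiableAt two_ne_zero)).2
    rw [← he, ← he', e.left_inv hu] at h
    have hFu : F (e u) = e' (f u) := by simp [F, e.left_inv hu]
    have h1 := absDetDeriv_pos d hlu
    have h2 := chartDensity_pos d x (e.map_source hu)
    have h3 := chartDensity_pos d (f x) (e'.map_source hfu)
    have h4 : (fderiv ℝ F (e u)).det ≠ 0 := by
      intro h0
      rw [← hF, h0, abs_zero, zero_mul] at h
      exact (mul_pos h1 h2).ne' h
    refine ⟨h4, ?_⟩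
    have h5 := congrArg Real.log h
    rw [Real.log_mul h1.ne' h2.ne', Real.log_mul (abs_ne_zero.2 h4) h3.ne', Real.log_abs] at h5
    rw [hFu]
    linarith
  have hpos' : chartDensity d (f x) (F (e x)) ≠ 0 := by
    rw [hFx]; exact (chartDensity_pos d (f x) (e'.map_source hfx)).ne'
  have hG : ContDiffAt ℝ 1 (fun y => Real.log (fderiv ℝ F y).det +
      Real.log (chartDensity d (f x) (F y)) - Real.log (chartDensity d x y)) (e x) :=
    ((hdet.log (key x hx hfx hf).1).add (hρ'.log hpos')).sub
      (hρ.log (chartDensity_pos d x (e.map_source hx)).ne')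
  obtain ⟨K, t, ht, hK⟩ := hG.exists_lipschitzOnWith
  obtain ⟨c, U, hU, hc⟩ := exists_nhds_dist_chartAt_le x hx
  refine ⟨K * |c|, by positivity, U ∩ (e.source ∩ (e ⁻¹' t ∩ (f ⁻¹' e'.source ∩
      {u | IsLocalDiffeomorphAt (𝓡 d) (𝓡 d) 2 f u}))), inter_mem hU (inter_mem
      (e.open_source.mem_nhds hx) (inter_mem ((e.continuousAt hx).preimage_mem_nhds ht)
      (inter_mem (hf.contMDiffAt.continuousAt.preimage_mem_nhds (e'.open_source.mem_nhds hfx))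
        hf.eventually))), ?_⟩
  rintro u ⟨hu1, hu2, hu3, hu4, hu5⟩ v ⟨hv1, hv2, hv3, hv4, hv5⟩
  rw [(key u hu2 hu4 hu5).2, (key v hv2 hv4 hv5).2, ← Real.dist_eq]
  refine (hK.dist_le_mul _ hu3 _ hv3).trans ?_
  rw [mul_assoc]
  refine mul_le_mul_of_nonneg_left ((hc u hu1 v hv1).trans ?_) K.2
  exact mul_le_mul_of_nonneg_right (le_abs_self c) dist_nonneg

end LogJacobian

/-! ### Expansion and bounded distortion at hyperbolic times. -/

section HyperbolicDistortion

open Metric Set HyperbolicTimes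

set_option linter.unusedSectionVars false

theorem truncDist_of_infDist_le {M : Type*} [MetricSpace M] {δ : ℝ} {S : Set M} {x : M}
    (hS : S.Nonempty) (h : infDist x S ≤ δ) : truncDist δ S x = infDist x S :=
  if_pos ⟨hS, h⟩

theorem truncDist_eq_zero_of_mem {M : Type*} [MetricSpace M] {δ : ℝ} (hδ : 0 < δ) {S : Set M}
    {x : M} (hx : x ∈ S) : truncDist δ S x = 0 := by
  have h0 : infDist x S = 0 := infDist_zero_of_mem hx
  rw [truncDist_of_infDist_le ⟨x, hx⟩ (by rw [h0]; exact hδ.le), h0]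

/-- A locally Lipschitz function on a compact space satisfies a uniform Lipschitz estimate at small
scales. -/
theorem exists_uniform_abs_sub_le {X : Type*} [MetricSpace X] [CompactSpace X] {φ : X → ℝ}
    (h : ∀ x, ∃ c : ℝ, 0 ≤ c ∧ ∃ U ∈ 𝓝 x, ∀ u ∈ U, ∀ v ∈ U, |φ u - φ v| ≤ c * dist u v) :
    ∃ r > 0, ∃ c : ℝ, 0 ≤ c ∧ ∀ w u, dist u w < r → |φ u - φ w| ≤ c * dist u w := by
  have H : ∃ r > 0, ∃ c : ℝ, 0 ≤ c ∧ ∀ w ∈ (univ : Set X), ∀ u, dist u w < r →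
      |φ u - φ w| ≤ c * dist u w := by
    refine isCompact_univ.induction_on (p := fun A : Set X => ∃ r > 0, ∃ c : ℝ, 0 ≤ c ∧
      ∀ w ∈ A, ∀ u, dist u w < r → |φ u - φ w| ≤ c * dist u w) ?_ ?_ ?_ ?_
    · exact ⟨1, one_pos, 0, le_rfl, fun w hw => hw.elim⟩
    · rintro A A' hA ⟨r, hr, c, hc, H⟩
      exact ⟨r, hr, c, hc, fun w hw => H w (hA hw)⟩
    · rintro A A' ⟨r, hr, c, hc, H⟩ ⟨r', hr', c', hc', H'⟩
      refine ⟨min r r', lt_min hr hr', max c c', le_max_of_le_left hc, ?_⟩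
      rintro w (hw | hw) u hu
      · exact (H w hw u (hu.trans_le (min_le_left _ _))).trans
          (mul_le_mul_of_nonneg_right (le_max_left _ _) dist_nonneg)
      · exact (H' w hw u (hu.trans_le (min_le_right _ _))).trans
          (mul_le_mul_of_nonneg_right (le_max_right _ _) dist_nonneg)
    · intro x _
      obtain ⟨c, hc, U, hU, H⟩ := h x
      obtain ⟨r, hr, hball⟩ := Metric.mem_nhds_iff.1 hU
      refine ⟨ball x (r / 2), mem_nhdsWithin_of_mem_nhds (ball_mem_nhds x (half_pos hr)),
        r / 2, half_pos hr, c, hc, fun w hw u hu => H u (hball ?_) w (hball ?_)⟩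
      · rw [mem_ball] at hw ⊢
        linarith [dist_triangle u w x]
      · exact ball_subset_ball (by linarith) hw
  obtain ⟨r, hr, c, hc, H⟩ := H
  exact ⟨r, hr, c, hc, fun w => H w (mem_univ w)⟩

variable (d : ℕ) {M : Type*} [MetricSpace M] [CompactSpace M]
  [ChartedSpace (EuclideanSpace ℝ (Fin d)) M]
  [IsManifold (𝓡 d) ∞ M] [RiemannianBundle (fun x : M => TangentSpace (𝓡 d) x)]
  [IsContMDiffRiemannianBundle (𝓡 d) ∞ (EuclideanSpace ℝ (Fin d))
    (fun x : M => TangentSpace (𝓡 d) x)]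
  [IsRiemannianManifold (𝓡 d) M]

theorem invDerivNorm_nonneg (f : M → M) (x : M) : 0 ≤ invDerivNorm d f x :=
  ContinuousLinearMap.opNorm_nonneg _

/-- Control of the derivative of `f` on balls whose radius decreases exponentially with `k`, around
points that are not too close to `S`. -/
theorem exists_distortion_bound (hd : d ≠ 0) {f : M → M} {S : Set M}
    (hfS : IsLocalDiffeomorphOn (𝓡 d) (𝓡 d) 2 f Sᶜ)
    {B β : ℝ} (hS : IsNondegenerateExceptionalSet d f S B β)
    {b : ℝ} (hb : b < min (1 / 2) (1 / (4 * β)))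
    {σ : ℝ} (hσ0 : 0 < σ) (hσ1 : σ < 1) {δ : ℝ} (hδ : 0 < δ) {ε : ℝ} (hε : 0 < ε) :
    ∃ ρ > 0, ∃ K : ℝ, 0 ≤ K ∧ ∀ k : ℕ, ∀ w, σ ^ (b * (k : ℝ)) ≤ truncDist δ S w →
      ∀ u, dist u w ≤ σ ^ ((k : ℝ) / 2) * ρ → u ∉ S ∧
        |Real.log (invDerivNorm d f u) - Real.log (invDerivNorm d f w)| ≤ ε ∧
        |Real.log (absDetDeriv d f u) - Real.log (absDetDeriv d f w)| ≤
          K * σ ^ ((k : ℝ) / 4) := by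
  have hσk : ∀ k : ℕ, σ ^ ((k : ℝ) / 2) ≤ σ ^ ((k : ℝ) / 4) := fun k =>
    Real.rpow_le_rpow_of_exponent_ge hσ0 hσ1.le (by have := k.cast_nonneg (α := ℝ); linarith)
  have hσ4 : ∀ k : ℕ, σ ^ ((k : ℝ) / 4) ≤ 1 := fun k =>
    Real.rpow_le_one hσ0.le hσ1.le (by positivity)
  -- For empty `S` the non-degeneracy conditions say nothing about `f`; smoothness and compactness
  -- supply both estimates.
  rcases S.eq_empty_or_nonempty with rfl | hne
  · have hloc : ∀ x, IsLocalDiffeomorphAt (𝓡 d) (𝓡 d) 2 f x := fun x => hfS ⟨x, by simp⟩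
    have hcont : Continuous fun x => Real.log (invDerivNorm d f x) :=
      continuous_iff_continuousAt.2 fun x =>
        (continuousAt_invDerivNorm (hloc x)).log (invDerivNorm_pos hd (hloc x)).ne'
    obtain ⟨r, hr, hrε⟩ := Metric.uniformContinuous_iff.1
      (CompactSpace.uniformContinuous_of_continuous hcont) ε hε
    obtain ⟨r', hr', c, hc, H⟩ := exists_uniform_abs_sub_le fun x =>
      exists_nhds_abs_log_absDetDeriv_sub_le d (hloc x)
    set ρ := min r r' / 2 with hρdef
    have hρ : 0 < ρ := half_pos (lt_min hr hr')
    have hρr : ρ < r := (half_lt_self (lt_min hr hr')).trans_le (min_le_left _ _)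
    have hρr' : ρ < r' := (half_lt_self (lt_min hr hr')).trans_le (min_le_right _ _)
    refine ⟨ρ, hρ, c * ρ, by positivity, fun k w _ u hu => ⟨notMem_empty u, ?_, ?_⟩⟩
    · have h1 : dist u w ≤ ρ := hu.trans
        (mul_le_of_le_one_left hρ.le ((hσk k).trans (hσ4 k)))
      exact (hrε (h1.trans_lt hρr)).le
    · have h1 : dist u w ≤ ρ := hu.trans
        (mul_le_of_le_one_left hρ.le ((hσk k).trans (hσ4 k)))
      refine (H w u (h1.trans_lt hρr')).trans ?_
      calc c * dist u w ≤ c * (σ ^ ((k : ℝ) / 4) * ρ) := by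
            refine mul_le_mul_of_nonneg_left (hu.trans ?_) hc
            exact mul_le_mul_of_nonneg_right (hσk k) hρ.le
        _ = _ := by ring
  · have hβ := hS.pos
    have hB : 0 < B := one_pos.trans hS.one_lt
    have hb2 : b < 1 / 2 := hb.trans_le (min_le_left _ _)
    have hb4 : b * β < 1 / 4 := by
      have h := hb.trans_le (min_le_right _ _)
      rw [lt_div_iff₀ (by positivity)] at h
      linarith
    -- This factor turns the lower bound on the truncated distance into one on the true distance,
    -- whether or not truncation occurs.
    set η := min 1 δ with hη
    have hη0 : 0 < η := lt_min one_pos hδ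
    set C := B / η ^ β with hC
    have hC0 : 0 < C := by positivity
    set ρ := min (η / 4) (ε / C) with hρdef
    have hρ : 0 < ρ := lt_min (by positivity) (by positivity)
    refine ⟨ρ, hρ, C * ρ, by positivity, fun k w hw u hu => ?_⟩
    have hk0 : (0 : ℝ) ≤ k := k.cast_nonneg
    have hD : η * σ ^ (b * (k : ℝ)) ≤ infDist w S := by
      by_cases h : infDist w S ≤ δ
      · rw [truncDist_of_infDist_le hne h] at hw
        exact (mul_le_of_le_one_left (by positivity) (min_le_left _ _)).trans hw
      · by_cases hb0 : σ ^ (b * (k : ℝ)) ≤ 1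
        · have h1 : η * σ ^ (b * (k : ℝ)) ≤ η := mul_le_of_le_one_right hη0.le hb0
          exact h1.trans ((min_le_right _ _).trans (not_le.1 h).le)
        · rw [truncDist, if_neg (fun h' => h h'.2)] at hw
          exact absurd hw hb0
    have hpos : 0 < σ ^ (b * (k : ℝ)) := Real.rpow_pos_of_pos hσ0 _
    have hD0 : 0 < infDist w S := (mul_pos hη0 hpos).trans_le hD
    have hwS : w ∉ S := fun h => hD0.ne' (infDist_zero_of_mem h)
    -- This is where b < 1/2 enters: it keeps `u` within half the distance from `w` to `S`.
    have hk2 : σ ^ ((k : ℝ) / 2) ≤ σ ^ (b * (k : ℝ)) :=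
      Real.rpow_le_rpow_of_exponent_ge hσ0 hσ1.le (by nlinarith)
    have hdist : dist w u < infDist w S / 2 := by
      rw [dist_comm]
      calc dist u w ≤ σ ^ ((k : ℝ) / 2) * ρ := hu
        _ ≤ σ ^ (b * (k : ℝ)) * (η / 4) := by
            gcongr
            exact min_le_left _ _
        _ < infDist w S / 2 := by nlinarith [mul_pos hη0 hpos]
    have huS : u ∉ S := fun h => by linarith [infDist_le_dist_of_mem (x := w) h]
    -- Since bβ < 1/4, the blow-up of the Lipschitz constant costs at most σ^(-k/4), half of the
    -- exponent gained from dist w u.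
    have hbound : B / infDist w S ^ β * dist w u ≤ C * ρ * σ ^ ((k : ℝ) / 4) := by
      have h1 : η ^ β * σ ^ ((k : ℝ) / 4) ≤ infDist w S ^ β := by
        calc η ^ β * σ ^ ((k : ℝ) / 4) ≤ η ^ β * σ ^ (b * k * β) := by
              gcongr η ^ β * ?_
              exact Real.rpow_le_rpow_of_exponent_ge hσ0 hσ1.le (by nlinarith)
          _ = (η * σ ^ (b * (k : ℝ))) ^ β := by
              rw [Real.mul_rpow hη0.le hpos.le, Real.rpow_mul hσ0.le]
          _ ≤ _ := Real.rpow_le_rpow (by positivity) hD hβ.le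
      have h2 : B / infDist w S ^ β ≤ B / (η ^ β * σ ^ ((k : ℝ) / 4)) := by gcongr
      have h3 : dist w u ≤ σ ^ ((k : ℝ) / 4) * σ ^ ((k : ℝ) / 4) * ρ := by
        rw [dist_comm, ← Real.rpow_add hσ0]
        convert hu using 3
        ring
      calc _ ≤ B / (η ^ β * σ ^ ((k : ℝ) / 4)) *
            (σ ^ ((k : ℝ) / 4) * σ ^ ((k : ℝ) / 4) * ρ) := by gcongr
        _ = _ := by rw [hC]; field_simp
    refine ⟨huS, ?_, ?_⟩
    · rw [abs_sub_comm]
      refine (hS.log_inv hne w hwS u huS hdist).trans (hbound.trans ?_)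
      calc C * ρ * σ ^ ((k : ℝ) / 4) ≤ C * ρ := mul_le_of_le_one_right (by positivity) (hσ4 k)
        _ ≤ C * (ε / C) := by gcongr; exact min_le_right _ _
        _ = ε := by field_simp
    · rw [abs_sub_comm]
      exact (hS.log_det hne w hwS u huS hdist).trans hbound

/-- At hyperbolic times there is a neighborhood on which the iterate expands, with bounded
distortion. -/
theorem exists_expandsWithDistortion_of_isHyperbolicTime (hd : d ≠ 0) {f : M → M} {S : Set M}
    (hfS : IsLocalDiffeomorphOn (𝓡 d) (𝓡 d) 2 f Sᶜ)
    {B β : ℝ} (hS : IsNondegenerateExceptionalSet d f S B β)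
    {b : ℝ} (hb : b < min (1 / 2) (1 / (4 * β)))
    {σ : ℝ} (hσ0 : 0 < σ) (hσ1 : σ < 1) {δ : ℝ} (hδ : 0 < δ) :
    ∃ ρ > 0, ∃ K : ℝ, ∀ n x, IsHyperbolicTime d f S b σ δ n x →
      ExpandsWithDistortion f S (absDetDeriv d f) ρ K n x := by
  -- The factor σ^(-1/2) in the rates chosen below leaves room 2ε in the logarithm, so an
  -- oscillation of ε keeps the expansion strict.
  set ε := -Real.log σ / 4 with hε
  have hlog : Real.log σ < 0 := Real.log_neg hσ0 hσ1
  have hε0 : 0 < ε := by rw [hε]; linarith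
  obtain ⟨ρ, hρ, K, hK, H⟩ := exists_distortion_bound d hd hfS hS hb hσ0 hσ1 hδ hε0
  set τ := σ ^ (1 / 4 : ℝ) with hτ
  have hτ0 : 0 ≤ τ := Real.rpow_nonneg hσ0.le _
  have hτ1 : τ < 1 := Real.rpow_lt_one hσ0.le hσ1 (by norm_num)
  have hτk : ∀ k : ℕ, σ ^ ((k : ℝ) / 4) = τ ^ k := fun k => by
    rw [hτ, ← Real.rpow_natCast, ← Real.rpow_mul hσ0.le]
    congr 1; ring
  refine ⟨ρ, hρ, K * (1 - τ)⁻¹, fun n x hn => ⟨fun i => σ ^ (-(1 / 2) : ℝ) *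
    invDerivNorm d f (f^[i] x), fun i => K * τ ^ (n - i), fun i => ?_, ?_, fun i hi u hu => ?_⟩⟩
  · exact mul_nonneg (Real.rpow_nonneg hσ0.le _) (invDerivNorm_nonneg d f _)
  · rw [← Finset.mul_sum]
    refine mul_le_mul_of_nonneg_left ?_ hK
    calc ∑ i ∈ Finset.range n, τ ^ (n - i) ≤ ∑ i ∈ Finset.range n, τ ^ (n - 1 - i) :=
          Finset.sum_le_sum fun i _ => pow_le_pow_of_le_one hτ0 hτ1.le (by omega)
      _ = ∑ i ∈ Finset.range n, τ ^ i := Finset.sum_range_reflect (fun i => τ ^ i) n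
      _ ≤ ∑' i, τ ^ i := (summable_geometric_of_lt_one hτ0 hτ1).sum_le_tsum _
          fun i _ => pow_nonneg hτ0 i
      _ = _ := tsum_geometric_of_lt_one hτ0 hτ1
  · obtain ⟨hprod, htr⟩ := hn (n - i) (by omega) (by omega)
    rw [Nat.sub_sub_self hi.le] at hprod htr
    -- Half of the hyperbolic contraction σ^(n-i) is spent on the oscillation of the derivative, the
    -- other half shrinks the ball.
    have hrad : ∏ j ∈ Finset.Ico i n, (σ ^ (-(1 / 2) : ℝ) * invDerivNorm d f (f^[j] x)) ≤
        σ ^ (((n - i : ℕ) : ℝ) / 2) := by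
      rw [Finset.prod_mul_distrib, Finset.prod_const, Nat.card_Ico]
      calc _ ≤ (σ ^ (-(1 / 2) : ℝ)) ^ (n - i) * σ ^ (n - i) := by gcongr
        _ = _ := by
          rw [← mul_pow, ← Real.rpow_add_one hσ0.ne', ← Real.rpow_natCast, ← Real.rpow_mul hσ0.le]
          congr 1; ring
    have hw := H (n - i) (f^[i] x) htr (f^[i] x)
      (by rw [dist_self]; positivity)
    have hwl := hfS ⟨f^[i] x, hw.1⟩
    obtain ⟨huS, hu1, hu2⟩ := H (n - i) (f^[i] x) htr u
      ((mem_closedBall.1 hu).trans (mul_le_mul_of_nonneg_right hrad hρ.le))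
    have hul : IsLocalDiffeomorphAt (𝓡 d) (𝓡 d) 2 f u := hfS ⟨u, huS⟩
    have hJu := absDetDeriv_pos d hul
    have hJw := absDetDeriv_pos d hwl
    rw [hτk, abs_le] at hu2
    refine ⟨huS, isLocallyExpandingAt_of_isLocalDiffeomorphAt hul ?_, ?_, ?_⟩
    · have hLu := invDerivNorm_pos hd hul
      have hLw := invDerivNorm_pos hd hwl
      rw [← Real.log_lt_log_iff hLu (by positivity), Real.log_mul (by positivity) hLw.ne',
        Real.log_rpow hσ0]
      have := (abs_le.1 hu1).2
      linarith
    · rw [← Real.log_le_log_iff hJu (by positivity), Real.log_mul (Real.exp_ne_zero _) hJw.ne',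
        Real.log_exp]
      linarith [hu2.2]
    · rw [← Real.log_le_log_iff (by positivity) hJu, Real.log_mul (Real.exp_ne_zero _) hJw.ne',
        Real.log_exp]
      linarith [hu2.1]

end HyperbolicDistortion

/-! ### Preimages of null sets are null. -/

section Nonsingular

open Metric Set HyperbolicTimes

theorem ControlsVolume.smul {X : Type*} [MeasurableSpace X] {f : X → X} {S : Set X} {J : X → ℝ}
    {m : Measure X} (h : ControlsVolume f S J m) (c : ℝ≥0∞) : ControlsVolume f S J (c • m) := by
  intro A hA hAS hinj α hα
  simp only [Measure.smul_apply, smul_eq_mul]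
  rw [mul_left_comm]
  exact ⟨fun H => mul_le_mul_right ((h A hA hAS hinj α hα).1 H) c,
    fun H => mul_le_mul_right ((h A hA hAS hinj α hα).2 H) c⟩

/-- Off the null set `S`, `f` is locally injective with `J` ≥ α > 0, so a piece B of the preimage
satisfies α m(B) ≤ m(f(B)) ≤ m(A) = 0. -/
theorem ControlsVolume.measure_preimage_eq_zero {X : Type*} [MetricSpace X] [CompactSpace X]
    [MeasurableSpace X] [BorelSpace X] {f : X → X} {S : Set X} {J : X → ℝ} {m : Measure X}
    (h : ControlsVolume f S J m) (hfc : Continuous f) (hf : IsLocalHomeomorphOn f Sᶜ)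
    (hS : IsClosed S) (hS0 : m S = 0) (hJ : ∀ x ∉ S, ∃ α > 0, ∀ᶠ u in 𝓝 x, α ≤ J u)
    {A : Set X} (hA : MeasurableSet A) (hA0 : m A = 0) : m (f ⁻¹' A) = 0 := by
  have key : m (f ⁻¹' A ∩ Sᶜ) = 0 := by
    refine measure_null_of_locally_null _ fun x hx => ?_
    obtain ⟨e, hxe, rfl⟩ := hf x hx.2
    obtain ⟨α, hα, hev⟩ := hJ x hx.2
    obtain ⟨V, hVJ, hVo, hxV⟩ := _root_.eventually_nhds_iff.1 hev
    have hN : V ∩ (e.source ∩ Sᶜ) ∈ 𝓝 x := inter_mem (hVo.mem_nhds hxV)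
      (inter_mem (e.open_source.mem_nhds hxe) (hS.isOpen_compl.mem_nhds hx.2))
    refine ⟨(e ⁻¹' A ∩ Sᶜ) ∩ (V ∩ (e.source ∩ Sᶜ)), inter_mem self_mem_nhdsWithin
      (mem_nhdsWithin_of_mem_nhds hN), ?_⟩
    have hB : MeasurableSet ((e ⁻¹' A ∩ Sᶜ) ∩ (V ∩ (e.source ∩ Sᶜ))) :=
      ((hfc.measurable hA).inter hS.measurableSet.compl).inter
        (hVo.measurableSet.inter (e.open_source.measurableSet.inter hS.measurableSet.compl))
    have h1 := (h _ hB (fun y hy => hy.1.2) (e.injOn.mono fun y hy => hy.2.2.1) α hα.le).2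
      fun y hy => hVJ y hy.2.1
    have h2 : m (e '' ((e ⁻¹' A ∩ Sᶜ) ∩ (V ∩ (e.source ∩ Sᶜ)))) = 0 := by
      refine measure_mono_null ?_ hA0
      rintro _ ⟨y, hy, rfl⟩
      exact hy.1.1
    rw [h2, nonpos_iff_eq_zero, mul_eq_zero] at h1
    exact h1.resolve_left (ENNReal.ofReal_pos.2 hα).ne'
  refine measure_mono_null (fun x hx => ?_) (measure_union_null hS0 key)
  by_cases hxS : x ∈ S
  · exact Or.inl hxS
  · exact Or.inr ⟨hx, hxS⟩

end Nonsingular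

/-! ### Uniform densities, concatenation and measurability of hyperbolic times. -/

section HyperbolicTimeSets

open Metric Set HyperbolicTimes

set_option linter.unusedSectionVars false

theorem measurable_truncDist {X : Type*} [MetricSpace X] [MeasurableSpace X] [BorelSpace X]
    (δ : ℝ) (S : Set X) : Measurable (truncDist δ S) := by
  classical
  have h : Measurable fun x => infDist x S := (continuous_infDist_pt S).measurable
  refine Measurable.ite ?_ h measurable_const
  by_cases hS : S.Nonempty
  · simpa [hS] using measurableSet_le h measurable_const
  · simp [hS]

/-- Finitely many sets with short paths cover `M`, each of positive measure; `C` is the sum of their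
constants exp(2K) m(M) / m(U). -/
theorem exists_measure_expandsWithDistortion_inter_le (d : ℕ) {M : Type*} [MetricSpace M]
    [CompactSpace M] [MeasurableSpace M] [BorelSpace M]
    [ChartedSpace (EuclideanSpace ℝ (Fin d)) M]
    [IsManifold (𝓡 d) ∞ M] [RiemannianBundle (fun x : M => TangentSpace (𝓡 d) x)]
    [IsContMDiffRiemannianBundle (𝓡 d) ∞ (EuclideanSpace ℝ (Fin d))
      (fun x : M => TangentSpace (𝓡 d) x)]
    [IsRiemannianManifold (𝓡 d) M]
    {f : M → M} {S : Set M} {J : M → ℝ} {m : Measure M} [IsFiniteMeasure m]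
    (hm : ∀ U : Set M, IsOpen U → U.Nonempty → 0 < m U) (hJ : ControlsVolume f S J m)
    (hJ0 : ∀ x ∉ S, 0 < J x) (hfc : Continuous f) (hS : IsClosed S)
    (hf : IsLocalHomeomorphOn f Sᶜ) {ρ : ℝ} (hρ : 0 < ρ) (K : ℝ) :
    ∃ C : ℝ≥0∞, C ≠ ⊤ ∧ ∀ n A, MeasurableSet A →
      m ({x | ExpandsWithDistortion f S J ρ K n x} ∩ f^[n] ⁻¹' A) ≤ C * m A := by
  choose U hpU hUo hUc hU using fun p : M => exists_hasShortPaths d hρ p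
  obtain ⟨t, -, ht⟩ := isCompact_univ.elim_nhds_subcover U fun p _ => (hUo p).mem_nhds (hpU p)
  have hU0 : ∀ p, m (U p) ≠ 0 := fun p => (hm _ (hUo p) ⟨p, hpU p⟩).ne'
  refine ⟨∑ p ∈ t, ENNReal.ofReal (Real.exp (2 * K)) * m univ * (m (U p))⁻¹, ?_,
    fun n A hA => ?_⟩
  · exact ENNReal.sum_ne_top.2 fun p _ => ENNReal.mul_ne_top (ENNReal.mul_ne_top
      ENNReal.ofReal_ne_top (measure_ne_top _ _)) (ENNReal.inv_ne_top.2 (hU0 p))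
  · have hsub : {x | ExpandsWithDistortion f S J ρ K n x} ∩ f^[n] ⁻¹' A ⊆
        ⋃ p ∈ t, {x | ExpandsWithDistortion f S J ρ K n x} ∩ f^[n] ⁻¹' (A ∩ U p) := by
      intro x hx
      obtain ⟨p, hp, hxp⟩ := mem_iUnion₂.1 (ht (mem_univ (f^[n] x)))
      exact mem_iUnion₂.2 ⟨p, hp, hx.1, hx.2, hxp⟩
    refine (measure_mono hsub).trans ((measure_biUnion_finset_le _ _).trans ?_)
    rw [Finset.sum_mul]
    refine Finset.sum_le_sum fun p _ => ?_
    have h := measure_expandsWithDistortion_inter_le hJ hJ0 hfc hS hf (K := K) hρ.le n (hUo p)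
      (hUc p) (hU p) (hA.inter (hUo p).measurableSet) inter_subset_right
    calc _ ≤ ENNReal.ofReal (Real.exp (2 * K)) * m (A ∩ U p) * m univ / m (U p) :=
          (ENNReal.le_div_iff_mul_le (Or.inl (hU0 p)) (Or.inl (measure_ne_top _ _))).2 h
      _ ≤ ENNReal.ofReal (Real.exp (2 * K)) * m A * m univ / m (U p) := by
          gcongr
          exact inter_subset_left
      _ = _ := by rw [div_eq_mul_inv]; ring

variable (d : ℕ) {M : Type*} [MetricSpace M] [CompactSpace M]
  [ChartedSpace (EuclideanSpace ℝ (Fin d)) M]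
  [IsManifold (𝓡 d) ∞ M] [RiemannianBundle (fun x : M => TangentSpace (𝓡 d) x)]
  [IsContMDiffRiemannianBundle (𝓡 d) ∞ (EuclideanSpace ℝ (Fin d))
    (fun x : M => TangentSpace (𝓡 d) x)]
  [IsRiemannianManifold (𝓡 d) M]

theorem isHyperbolicTime_zero (f : M → M) (S : Set M) (b σ δ : ℝ) (x : M) :
    IsHyperbolicTime d f S b σ δ 0 x := fun k h1 h2 => by omega

/-- Looking back l ≤ k steps only involves the orbit of `f^[i] x`. For l > k the product splits at
time `i`, and the required distance σ^(bl) is no larger than the known σ^(b(l-k)). -/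
theorem IsHyperbolicTime.add {f : M → M} {S : Set M} {b σ δ : ℝ} (hb : 0 ≤ b) (hσ0 : 0 < σ)
    (hσ1 : σ ≤ 1) {i k : ℕ} {x : M} (hi : IsHyperbolicTime d f S b σ δ i x)
    (hk : IsHyperbolicTime d f S b σ δ k (f^[i] x)) : IsHyperbolicTime d f S b σ δ (i + k) x := by
  have hprod : ∀ l ≤ k, ∏ j ∈ Finset.Ico (i + k - l) (i + k), invDerivNorm d f (f^[j] x) =
      ∏ j ∈ Finset.Ico (k - l) k, invDerivNorm d f (f^[j] (f^[i] x)) := by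
    intro l hl
    have h := Finset.prod_Ico_add (fun j => invDerivNorm d f (f^[j] x)) (k - l) k i
    rw [show k - l + i = i + k - l by omega, show k + i = i + k by omega] at h
    rw [← h]
    exact Finset.prod_congr rfl fun j _ => by rw [← Function.iterate_add_apply, add_comm i j]
  intro l hl1 hl2
  rcases le_or_gt l k with hlk | hlk
  · obtain ⟨h1, h2⟩ := hk l hl1 hlk
    rw [← Function.iterate_add_apply, show k - l + i = i + k - l by omega] at h2
    exact ⟨(hprod l hlk).trans_le h1, h2⟩
  · obtain ⟨h1, h2⟩ := hi (l - k) (by omega) (by omega)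
    rw [show i - (l - k) = i + k - l by omega] at h1 h2
    have h3 : ∏ j ∈ Finset.Ico i (i + k), invDerivNorm d f (f^[j] x) ≤ σ ^ k := by
      rcases Nat.eq_zero_or_pos k with rfl | hk0
      · simp
      · have h := hprod k le_rfl
        rw [Nat.add_sub_cancel] at h
        exact h.trans_le (hk k hk0 le_rfl).1
    refine ⟨?_, le_trans ?_ h2⟩
    · rw [← Finset.prod_Ico_consecutive _ (show i + k - l ≤ i by omega) (Nat.le_add_right i k)]
      calc _ ≤ σ ^ (l - k) * σ ^ k :=
            mul_le_mul h1 h3 (Finset.prod_nonneg fun j _ => invDerivNorm_nonneg d f _)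
              (by positivity)
        _ = σ ^ l := by rw [← pow_add, Nat.sub_add_cancel hlk.le]
    · refine Real.rpow_le_rpow_of_exponent_ge hσ0 hσ1 ?_
      exact mul_le_mul_of_nonneg_left (Nat.cast_le.2 (Nat.sub_le l k)) hb

theorem measurableSet_isHyperbolicTime [MeasurableSpace M] [BorelSpace M] {f : M → M}
    (hf : Continuous f) {S : Set M} (hS : IsClosed S)
    (hfS : IsLocalDiffeomorphOn (𝓡 d) (𝓡 d) 2 f Sᶜ) (b : ℝ) {σ : ℝ} (hσ : 0 < σ) {δ : ℝ}
    (hδ : 0 < δ) (n : ℕ) : MeasurableSet {x | IsHyperbolicTime d f S b σ δ n x} := by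
  classical
  -- Continuity of ‖Df⁻¹‖ is known only off `S`. Replacing it by 0 on `S` is harmless: the truncated
  -- distance vanishes there, so the distance condition excludes orbits meeting `S` before time `n`.
  let g : M → ℝ := Sᶜ.piecewise (invDerivNorm d f) fun _ => 0
  have hg : Measurable g := ContinuousOn.measurable_piecewise
    (fun x hx => (continuousAt_invDerivNorm (hfS ⟨x, hx⟩)).continuousWithinAt)
    continuousOn_const hS.measurableSet.compl
  have hit : ∀ j, Measurable f^[j] := fun j => (hf.iterate j).measurable
  have heq : {x | IsHyperbolicTime d f S b σ δ n x} = ⋂ k, ⋂ (_ : 1 ≤ k), ⋂ (_ : k ≤ n),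
      {x | ∏ j ∈ Finset.Ico (n - k) n, g (f^[j] x) ≤ σ ^ k} ∩
        {x | σ ^ (b * (k : ℝ)) ≤ truncDist δ S (f^[n - k] x)} := by
    ext x
    simp only [mem_iInter, mem_inter_iff, mem_ofPred_eq]
    have key : (∀ k : ℕ, 1 ≤ k → k ≤ n → σ ^ (b * (k : ℝ)) ≤ truncDist δ S (f^[n - k] x)) →
        ∀ j < n, g (f^[j] x) = invDerivNorm d f (f^[j] x) := by
      intro h j hj
      refine piecewise_eq_of_mem _ _ _ fun hjS => ?_
      have h1 := h (n - j) (by omega) (by omega)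
      rw [Nat.sub_sub_self hj.le, truncDist_eq_zero_of_mem hδ hjS] at h1
      exact (Real.rpow_pos_of_pos hσ _).not_ge h1
    constructor
    · intro h k hk1 hk2
      rw [Finset.prod_congr rfl fun j hj => key (fun k h1 h2 => (h k h1 h2).2) j
        (Finset.mem_Ico.1 hj).2]
      exact h k hk1 hk2
    · intro h k hk1 hk2
      rw [← Finset.prod_congr rfl fun j hj => key (fun k h1 h2 => (h k h1 h2).2) j
        (Finset.mem_Ico.1 hj).2]
      exact h k hk1 hk2
  rw [heq]
  refine MeasurableSet.iInter fun k => MeasurableSet.iInter fun _ => MeasurableSet.iInter fun _ =>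
    MeasurableSet.inter ?_ ?_
  · exact measurableSet_le (Finset.measurable_prod _ fun j _ => hg.comp (hit j)) measurable_const
  · exact measurableSet_le measurable_const ((measurable_truncDist δ S).comp (hit _))

theorem isProbabilityMeasure_lebesgue [Nonempty M] [MeasurableSpace M] [BorelSpace M] :
    IsProbabilityMeasure (lebesgue d M) := by
  have := isFiniteMeasure_riemannianVolume d (M := M)
  exact ⟨ENNReal.inv_mul_cancel (riemannianVolume_pos d isOpen_univ univ_nonempty).ne'
    (measure_ne_top _ _)⟩

/-- The Riemannian distance is finite, so any two points are joined by a curve, which is constant in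
a discrete space. -/
theorem subsingleton_of_dim_eq_zero {M : Type*} [MetricSpace M]
    [ChartedSpace (EuclideanSpace ℝ (Fin 0)) M]
    [IsManifold (𝓡 0) ∞ M] [RiemannianBundle (fun x : M => TangentSpace (𝓡 0) x)]
    [IsRiemannianManifold (𝓡 0) M] : Subsingleton M := by
  have hdisc : DiscreteTopology M := by
    refine discreteTopology_iff_isOpen_singleton.2 fun x => ?_
    have h : (chartAt (EuclideanSpace ℝ (Fin 0)) x).source = {x} := by
      refine subset_antisymm (fun y hy => ?_) (singleton_subset_iff.2 (mem_chart_source _ x))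
      exact (chartAt _ x).injOn hy (mem_chart_source _ x) (Subsingleton.elim _ _)
    rw [← h]
    exact (chartAt _ x).open_source
  refine ⟨fun x y => ?_⟩
  have h : Manifold.riemannianEDist (𝓡 0) x y < ⊤ := by
    rw [← IsRiemannianManifold.out (I := 𝓡 0) x y]
    exact edist_lt_top x y
  obtain ⟨γ, h0, h1, hγ, -⟩ := Manifold.exists_lt_of_riemannianEDist_lt h
  have hpc : IsPreconnected (γ '' Icc 0 1) := isPreconnected_Icc.image _ hγ.continuousOn
  rw [← h0, ← h1]
  exact hpc.subsingleton ⟨0, by simp, rfl⟩ ⟨1, by simp, rfl⟩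

end HyperbolicTimeSets
-- Assembly of the theorem.
theorem theoremB (d : ℕ) {M : Type*} [MetricSpace M] [CompactSpace M] [Nonempty M]
    [MeasurableSpace M] [BorelSpace M]
    [ChartedSpace (EuclideanSpace ℝ (Fin d)) M] [IsManifold (𝓡 d) ∞ M]
    [RiemannianBundle (fun x : M => TangentSpace (𝓡 d) x)]
    [IsContMDiffRiemannianBundle (𝓡 d) ∞ (EuclideanSpace ℝ (Fin d))
      (fun x : M => TangentSpace (𝓡 d) x)]
    [IsRiemannianManifold (𝓡 d) M]
    (f : M → M) (hf : Continuous f)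
    (S : Set M) (hScompact : IsCompact S) (hSsub : HyperbolicTimes.IsSubmanifoldOfLowerDim d S)
    (hfS : IsLocalDiffeomorphOn (𝓡 d) (𝓡 d) 2 f Sᶜ)
    (B β : ℝ) (hS : HyperbolicTimes.IsNondegenerateExceptionalSet d f S B β)
    (b : ℝ) (hb0 : 0 < b) (hb : b < min (1 / 2) (1 / (4 * β)))
    (σ : ℝ) (hσ0 : 0 < σ) (hσ1 : σ < 1) (δ : ℝ) (hδ : 0 < δ)
    (hint : ∫⁻ x, (HyperbolicTimes.firstHyperbolicTime d f S b σ δ x : ℝ≥0∞)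
      ∂(HyperbolicTimes.lebesgue d M) < ⊤) :
    (∃ μ : Measure M, IsProbabilityMeasure μ ∧ MeasurePreserving f μ μ ∧
      μ ≪ HyperbolicTimes.lebesgue d M) ∧
    ∀ μ : Measure M, IsProbabilityMeasure μ →
      HyperbolicTimes.IsWeakStarAccPt (HyperbolicTimes.cesaroAverage d M f) μ →
      MeasurePreserving f μ μ ∧ μ ≪ HyperbolicTimes.lebesgue d M := by
  have hprob : IsProbabilityMeasure (HyperbolicTimes.lebesgue d M) :=
    isProbabilityMeasure_lebesgue d
  -- In dimension 0 the norm of the inverse derivative is 0, so its logarithm carries no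
  -- information; there `M` is a single point.
  rcases eq_or_ne d 0 with rfl | hd
  · have hsub : Subsingleton M := subsingleton_of_dim_eq_zero
    have hac : ∀ μ : Measure M, MeasurePreserving f μ μ ∧ μ ≪ HyperbolicTimes.lebesgue 0 M := by
      intro μ
      have hfid : f = id := Subsingleton.elim _ _
      refine ⟨hfid ▸ MeasurePreserving.id μ, fun A hA => ?_⟩
      rcases A.eq_empty_or_nonempty with rfl | hne
      · exact measure_empty
      · rw [Subsingleton.eq_univ_of_nonempty hne, measure_univ] at hA
        exact absurd hA one_ne_zero
    exact ⟨⟨_, hprob, hac _⟩, fun μ _ _ => hac μ⟩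
  have hSc : IsClosed S := hScompact.isClosed
  have hld : ∀ x ∉ S, IsLocalDiffeomorphAt (𝓡 d) (𝓡 d) 2 f x := fun x hx => hfS ⟨x, hx⟩
  have hlh : IsLocalHomeomorphOn f Sᶜ := hfS.isLocalHomeomorphOn
  have hJ : ControlsVolume f S (HyperbolicTimes.absDetDeriv d f) (HyperbolicTimes.lebesgue d M) :=
    (controlsVolume_riemannianVolume d hf fun x hx =>
      (hld x hx).mdifferentiableAt two_ne_zero).smul _
  have hS0 : HyperbolicTimes.lebesgue d M S = 0 := by
    rw [HyperbolicTimes.lebesgue, Measure.smul_apply,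
      riemannianVolume_eq_zero_of_isSubmanifoldOfLowerDim d hSc hSsub, smul_zero]
  have hpos : ∀ U : Set M, IsOpen U → U.Nonempty → 0 < HyperbolicTimes.lebesgue d M U := by
    intro U hU hne
    have := isFiniteMeasure_riemannianVolume d (M := M)
    exact ENNReal.mul_pos (ENNReal.inv_ne_zero.2 (measure_ne_top _ _))
      (riemannianVolume_pos d hU hne).ne'
  have hJlow : ∀ x ∉ S, ∃ α > 0, ∀ᶠ u in 𝓝 x, α ≤ HyperbolicTimes.absDetDeriv d f u := by
    intro x hx
    obtain ⟨c, hc, U, hU, hlip⟩ := exists_nhds_abs_log_absDetDeriv_sub_le d (hld x hx)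
    -- Within distance 1 of `x` the Lipschitz bound lets log |det Df| drop by at most `c`.
    refine ⟨Real.exp (Real.log (HyperbolicTimes.absDetDeriv d f x) - c), Real.exp_pos _, ?_⟩
    filter_upwards [hU, (hld x hx).eventually, Metric.ball_mem_nhds x one_pos] with u hu hlu hux
    rw [← Real.le_log_iff_exp_le (absDetDeriv_pos d hlu)]
    have h1 := (abs_le.1 (hlip u hu x (mem_of_mem_nhds hU))).1
    have h2 : c * dist u x ≤ c := mul_le_of_le_one_right hc (Metric.mem_ball.1 hux).le
    linarith
  obtain ⟨ρ, hρ, K, hK⟩ := exists_expandsWithDistortion_of_isHyperbolicTime d hd hfS hS hb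
    hσ0 hσ1 hδ
  obtain ⟨C, hC, hdens⟩ := exists_measure_expandsWithDistortion_inter_le d hpos hJ
    (fun x hx => absDetDeriv_pos d (hld x hx)) hf hSc hlh hρ K
  obtain ⟨lam, hfin, hlam, hle⟩ := exists_dominating_measure hf (HyperbolicTimes.lebesgue d M)
    (fun A hA hA0 => hJ.measure_preimage_eq_zero hf hlh hSc hS0 hJlow hA hA0)
    (fun n => {x | HyperbolicTimes.IsHyperbolicTime d f S b σ δ n x})
    (measurableSet_isHyperbolicTime d hf hSc hfS b hσ0 hδ)
    (Set.eq_univ_of_forall (isHyperbolicTime_zero d f S b σ δ))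
    (fun i k x hi hk => IsHyperbolicTime.add d hb0.le hσ0 hσ1.le hi hk) hC
    (fun n A hA => (measure_mono (Set.inter_subset_inter_left _ (hK n))).trans (hdens n A hA))
    hint
  exact exists_absolutelyContinuous_of_dominating hf _ hlam hle
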